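/- Let $X\subseteq\mathbb R^n$ be open, let $E:X\to\mathbb R^{n\times n}$ and $F:X\to\mathbb R^n$ be $C^\infty$, and consider the DAE $\Xi:\ E(x)\dot x=F(x)$. A solution of $\Xi$ is a differentiable curve $x:I\to X$ on an open interval $I$ with $E(x(t))\dot x(t)=F(x(t))$ for all $t\in I$; a point is consistent if some solution passes through it, and inconsistent otherwise. For $M\subseteq\mathbb R^n$ and $x\in M$, let $T_xM$ be the set of velocities at $x$ of smooth curves in $M$. Fix $x_p\in X$ and an open neighbourhood $U\subseteq X$ of $x_p$, and assume the following. (CR) $\operatorname{rank}E(x)=r$ is constant on $U$; there is a smooth $Q_0:U\to GL(n,\mathbb R)$ such that $Q_0E=\begin{bmatrix}E_1\\0\end{bmatrix}$ with $E_1$ of full row rank; writing $Q_0F=\begin{bmatrix}F_1\\F_2\end{bmatrix}$ and $Z=\{x\in U: F_2(x)=0\}$, we have $F_2(x_p)=0$, $\operatorname{rank}\mathrm DF_2(x)$ and $\dim E(x)\ker \mathrm DF_2(x)$ are constant for $x\in Z$, and $T_xZ=\ker\mathrm DF_2(x)$ for all $x\in Z$. (Index 1) $\Xi$ has geometric index $1$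 around $x_p$: with $M_0=X$ and $M_{k+1}=\{x\in M_k: F(x)\in E(x)T_xM_k\}$, the number $k=1$ is the least $k$ such that $x_p\in M_k$ and, on a neighbourhood of $x_p$, $M_0,\dots,M_k$ are smooth embedded submanifolds and for every $x\in M_k$ there is exactly one $v\in T_xM_k$ with $E(x)v=F(x)$. (Involutivity) The distribution $\ker E$ is involutive on $U$. Say that $\Xi$ is equivalent on an open neighbourhood $V$ of $x_p$ to the index-1 nonlinear Weierstrass form (INWF) $$\dot\xi_1=F^*(\xi_1),\qquad 0=\xi_2,\qquad (\xi_1,\xi_2)\in X_1\times X_2$$ ($X_1\subseteq\mathbb R^{r}$, $X_2\subseteq\mathbb R^{n-r}$ open, $F^*$ smooth) via $Q:V\to GL(n,\mathbb R)$ and a diffeomorphism $\psi:V\to X_1\times X_2$ if for all $x\in V$ $$Q(x)E(x)\Big(\frac{\partial\psi(x)}{\partial x}\Big)^{-1}=\begin{bmatrix}I_r&0\\0&0\end{bmatrix},\qquad Q(x)F(x)=\begin{bmatrix}F^*(\psi_1(x))\\ \psi_2(x)\end{bmatrix}.$$ Then: 1. There is an open neighbourhood $V\subseteq U$ of $x_p$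 on which $\Xi$ is equivalent to an INWF via some smooth $Q$ and some $\psi$. 2. Let $V\subseteq U$ be any open neighbourhood of $x_p$ on which $\Xi$ is equivalent to an INWF via $Q$ and $\psi$. For $\epsilon>0$ and $x\in V$ the matrix $$E_\epsilon(x,\epsilon)=E(x)+Q(x)^{-1}\begin{bmatrix}0&0\\0&-\epsilon I_{n-r}\end{bmatrix}\frac{\partial\psi(x)}{\partial x}$$ is invertible. Let $x_0^-\in V$ be inconsistent, and let $x_0^+=\psi^{-1}\circ\pi\circ\psi(x_0^-)$ with $\pi(\xi_1,\xi_2)=(\xi_1,0)$. Then $x_0^+$ is well defined, lies in $V$, and is consistent. Let $I=(0,T)$ with $T\in(0,\infty]$. Suppose that for all sufficiently small $\epsilon>0$ the curve $\bar x(\cdot,\epsilon):I\to V$ solves $\dot x=E_\epsilon(x,\epsilon)^{-1}F(x)$ and starts from $x_0^-$, i.e. $\bar x(t,\epsilon)\to x_0^-$ as $t\to0^+$, and that $x:I\to V$ is a solution of $\Xi$ that starts from $x_0^+$, i.e. $x(t)\to x_0^+$ as $t\to0^+$. Then $$\lim_{\epsilon\to0^+}\|\bar x(t,\epsilon)-x(t)\|=0\qquad\text{for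 all }t\in I.$$ -/

import Mathlib

open Set Filter Topology
open scoped ContDiff

/-- The Euclidean space `ℝⁿ`. -/
abbrev Vec (n : ℕ) : Type := EuclideanSpace ℝ (Fin n)

/-- A (square) nonlinear DAE `E(x) ẋ = F(x)` with smooth coefficients on an open set `X`. The values
of `E` and `F` outside `X` are never used. The ambient space is `ℝⁿ`, or `ℝʳ × ℝˢ` for a DAE
written in split coordinates. -/
structure DAE (V : Type) [NormedAddCommGroup V] [NormedSpace ℝ V] where
  X : Set V
  E : V → V →L[ℝ] V
  F : V → V
  isOpen_X : IsOpen X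
  smooth_E : ContDiffOn ℝ ∞ E X
  smooth_F : ContDiffOn ℝ ∞ F X

section Submanifolds

variable {V : Type} [NormedAddCommGroup V] [NormedSpace ℝ V]

/-- `M` is a smooth embedded submanifold (without boundary): locally a regular level set of a
smooth submersion. -/
def IsSmoothSubmanifold (M : Set V) : Prop :=
  ∀ x ∈ M, ∃ (m : ℕ) (W : Set V) (g : V → Vec m),
    IsOpen W ∧ x ∈ W ∧ ContDiffOn ℝ ∞ g W ∧
    (∀ y ∈ W, Function.Surjective (fderiv ℝ g y)) ∧
    M ∩ W = {y ∈ W | g y = 0}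

/-- `T_x M`: the velocities at `x` of smooth curves that run in `M`. -/
def tangentSpaceAt (M : Set V) (x : V) : Set V :=
  {v | ∃ γ : ℝ → V, ContDiffAt ℝ ∞ γ 0 ∧ γ 0 = x ∧ HasDerivAt γ v 0 ∧ ∀ᶠ t in 𝓝 0, γ t ∈ M}

end Submanifolds

namespace DAE

section General

variable {V : Type} [NormedAddCommGroup V] [NormedSpace ℝ V]
variable {V' : Type} [NormedAddCommGroup V'] [NormedSpace ℝ V']

/-- The curve `x : I → X` is differentiable and solves `E(x) ẋ = F(x)` on the open set `I` of
times. -/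
def IsSolutionOn (Ξ : DAE V) (I : Set ℝ) (x : ℝ → V) : Prop :=
  ∀ t ∈ I, x t ∈ Ξ.X ∧ ∃ v : V, HasDerivAt x v t ∧ Ξ.E (x t) v = Ξ.F (x t)

/-- `x₀` is consistent: some solution on an open interval passes through `x₀`. -/
def IsConsistent (Ξ : DAE V) (x₀ : V) : Prop :=
  ∃ (a b t₀ : ℝ) (x : ℝ → V), t₀ ∈ Ioo a b ∧ Ξ.IsSolutionOn (Ioo a b) x ∧ x t₀ = x₀

/-- The geometric reduction: `M₀ = X` and `M_{k+1} = {x ∈ M_k | F(x) ∈ E(x) T_x M_k}`. -/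
def reduction (Ξ : DAE V) : ℕ → Set V
  | 0 => Ξ.X
  | k + 1 => {x ∈ Ξ.reduction k | ∃ v ∈ tangentSpaceAt (Ξ.reduction k) x, Ξ.E x v = Ξ.F x}

/-- After `k` steps the geometric reduction around `x_p` has reached the maximal invariant
submanifold and delivers the solutions: near `x_p` the sets `M₀, …, M_k` are submanifolds, and at
every point of `M_k` the DAE determines exactly one velocity tangent to `M_k` (so that
`M_{k+1} = M_k` there, and the DAE is an ODE `ẋ = v(x)` on `M_k`). -/
def ReductionEndsAt (Ξ : DAE V) (xp : V) (k : ℕ) : Prop :=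
  xp ∈ Ξ.reduction k ∧ ∃ W : Set V, IsOpen W ∧ xp ∈ W ∧
    (∀ j ≤ k, IsSmoothSubmanifold (Ξ.reduction j ∩ W)) ∧
    ∀ x ∈ Ξ.reduction k ∩ W,
      ∃! v : V, v ∈ tangentSpaceAt (Ξ.reduction k) x ∧ Ξ.E x v = Ξ.F x

/-- The geometric index of the DAE around `x_p` is `k`: the least number of steps after which the
reduction ends. -/
def HasGeometricIndex (Ξ : DAE V) (xp : V) (k : ℕ) : Prop :=
  IsLeast {j : ℕ | Ξ.ReductionEndsAt xp j} k

/-- The distribution `ker E` is involutive on `U`: the Lie bracket of any two smooth local sections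
is again a section. -/
def KerInvolutiveOn (Ξ : DAE V) (U : Set V) : Prop :=
  ∀ W : Set V, IsOpen W → W ⊆ U → ∀ f g : V → V,
    ContDiffOn ℝ ∞ f W → ContDiffOn ℝ ∞ g W →
    (∀ x ∈ W, Ξ.E x (f x) = 0) → (∀ x ∈ W, Ξ.E x (g x) = 0) →
    ∀ x ∈ W, Ξ.E x (VectorField.lieBracket ℝ f g x) = 0

/-- `Ξ`, restricted to the domain of the diffeomorphism `ψ`, is externally equivalent to `Ξ'` via
`Q` and `ψ`: here `ψ` is a smooth diffeomorphism from the open set `ψ.source ⊆ X` onto `X'`, `Q(x)`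
is invertible, and `E'(ψ(x)) = Q(x) E(x) (∂ψ/∂x)⁻¹`, `F'(ψ(x)) = Q(x) F(x)`. -/
structure IsLocallyExEquivVia (Ξ : DAE V) (Ξ' : DAE V') (Q : V → V →L[ℝ] V')
    (ψ : OpenPartialHomeomorph V V') : Prop where
  source_subset : ψ.source ⊆ Ξ.X
  target_eq : ψ.target = Ξ'.X
  smooth : ContDiffOn ℝ ∞ ψ ψ.source
  smooth_symm : ContDiffOn ℝ ∞ ψ.symm ψ.target
  invertible : ∀ x ∈ ψ.source, (Q x).IsInvertible
  map_E : ∀ x ∈ ψ.source, Ξ'.E (ψ x) = Q x ∘L Ξ.E x ∘L (fderiv ℝ ψ x).inverse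
  map_F : ∀ x ∈ ψ.source, Ξ'.F (ψ x) = Q x (Ξ.F x)

end General

/-- A DAE in the index-1 nonlinear Weierstrass form `ξ̇₁ = F*(ξ₁)`, `0 = ξ₂` on `X₁ × X₂`. -/
def IsINWF {r s : ℕ} (Ξ : DAE (Vec r × Vec s)) : Prop :=
  ∃ (X₁ : Set (Vec r)) (X₂ : Set (Vec s)) (Fstar : Vec r → Vec r),
    IsOpen X₁ ∧ IsOpen X₂ ∧ Ξ.X = X₁ ×ˢ X₂ ∧
    ∀ ξ ∈ Ξ.X,
      Ξ.E ξ = (ContinuousLinearMap.id ℝ (Vec r)).prodMap (0 : Vec s →L[ℝ] Vec s) ∧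
      Ξ.F ξ = (Fstar ξ.1, ξ.2)

section Euclidean

variable {n r s : ℕ}

/-- `Ξ` is locally, on `V`, externally equivalent to an INWF via `Q` and `ψ`. -/
def IsEquivINWFOn (Ξ : DAE (Vec n)) (V : Set (Vec n)) (Q : Vec n → Vec n →L[ℝ] Vec r × Vec s)
    (ψ : OpenPartialHomeomorph (Vec n) (Vec r × Vec s)) : Prop :=
  ψ.source = V ∧
    ∃ Ξ' : DAE (Vec r × Vec s), Ξ'.IsINWF ∧ Ξ.IsLocallyExEquivVia Ξ' Q ψ

/-- A smooth invertible row transformation on `U` that brings `E` to the form `[E₁; 0]` with `E₁` of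
full row rank `r`. -/
structure IsRowReduction (Ξ : DAE (Vec n)) (U : Set (Vec n))
    (Q : Vec n → Vec n →L[ℝ] Vec r × Vec s) : Prop where
  smooth : ContDiffOn ℝ ∞ Q U
  invertible : ∀ x ∈ U, (Q x).IsInvertible
  surjective_fst : ∀ x ∈ U, Function.Surjective fun v => (Q x (Ξ.E x v)).1
  snd_eq_zero : ∀ x ∈ U, ∀ v, (Q x (Ξ.E x v)).2 = 0

/-- The algebraic part `F₂` of `Q F = (F₁, F₂)`. -/
def algebraicPart (Ξ : DAE (Vec n)) (Q : Vec n → Vec n →L[ℝ] Vec r × Vec s) (x : Vec n) : Vec s :=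
  (Q x (Ξ.F x)).2

/-- The constant rank condition (CR) on an open neighbourhood `U` of `x_p`, with `F₂(x_p) = 0`: the
rank of `E` is constant on `U`; on the zero set of `F₂` in `U` the rank of `D F₂` is constant (in
the sense of the constant rank theorem: the zero set is cut out cleanly, its tangent space being
`ker D F₂`), and so is the rank of `E ker D F₂`. -/
def ConstantRankOn (Ξ : DAE (Vec n)) (xp : Vec n) (U : Set (Vec n)) : Prop :=
  IsOpen U ∧ xp ∈ U ∧ U ⊆ Ξ.X ∧
  ∃ (r s : ℕ) (Q : Vec n → Vec n →L[ℝ] Vec r × Vec s),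
    (∀ x ∈ U, Module.finrank ℝ (LinearMap.range (Ξ.E x).toLinearMap) = r) ∧
    Ξ.IsRowReduction U Q ∧
    Ξ.algebraicPart Q xp = 0 ∧
    (∃ ρ : ℕ, ∀ x ∈ U, Ξ.algebraicPart Q x = 0 →
      Module.finrank ℝ (LinearMap.range (fderiv ℝ (Ξ.algebraicPart Q) x).toLinearMap) = ρ) ∧
    (∀ x ∈ U, Ξ.algebraicPart Q x = 0 →
      tangentSpaceAt {y ∈ U | Ξ.algebraicPart Q y = 0} x =
        {v | fderiv ℝ (Ξ.algebraicPart Q) x v = 0}) ∧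
    (∃ σ : ℕ, ∀ x ∈ U, Ξ.algebraicPart Q x = 0 →
      Module.finrank ℝ ((LinearMap.ker (fderiv ℝ (Ξ.algebraicPart Q) x).toLinearMap).map
        (Ξ.E x).toLinearMap) = σ)

/-- The nonlinear consistency projector `ψ⁻¹ ∘ π ∘ ψ`, with `π(ξ₁, ξ₂) = (ξ₁, 0)`. -/
def consistencyProjector (ψ : OpenPartialHomeomorph (Vec n) (Vec r × Vec s)) (x : Vec n) : Vec n :=
  ψ.symm ((ψ x).1, 0)

/-- `E_ε(x, ε) = E(x) + Q(x)⁻¹ diag(0, -ε I) ∂ψ/∂x`. -/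
noncomputable def perturbedE (Ξ : DAE (Vec n)) (Q : Vec n → Vec n →L[ℝ] Vec r × Vec s)
    (ψ : OpenPartialHomeomorph (Vec n) (Vec r × Vec s)) (ε : ℝ) (x : Vec n) :
    Vec n →L[ℝ] Vec n :=
  Ξ.E x + (Q x).inverse ∘L
    (0 : Vec r →L[ℝ] Vec r).prodMap ((-ε) • ContinuousLinearMap.id ℝ (Vec s)) ∘L fderiv ℝ ψ x

/-- The curve `x : I → V` solves the perturbed system `ẋ = E_ε(x, ε)⁻¹ F(x)`. -/
def IsPerturbedSolutionOn (Ξ : DAE (Vec n)) (Q : Vec n → Vec n →L[ℝ] Vec r × Vec s)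
    (ψ : OpenPartialHomeomorph (Vec n) (Vec r × Vec s)) (ε : ℝ) (V : Set (Vec n)) (I : Set ℝ)
    (x : ℝ → Vec n) : Prop :=
  ∀ t ∈ I, x t ∈ V ∧ HasDerivAt x ((Ξ.perturbedE Q ψ ε (x t)).inverse (Ξ.F (x t))) t

end Euclidean

end DAE

/-! Existence of the normal form. Row reduction turns the DAE into `E₁ ẋ = F₁`, `0 = F₂`, and on `U`
the set `M₁` is the zero set of `F₂`. Adding to the tangent velocity at `xp` a vector `w` with `E₁ w
= 0` and `DF₂ w = 0` gives another admissible velocity, so uniqueness forces `w = 0`; by dimension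
`(E₁, DF₂)` is invertible at `xp`. Used as linear coordinates `(y, z)`, it makes `ker E` near `xp`
the graph of some `L(x) : Z → Y`, and involutivity becomes the integrability condition of `∂y/∂z =
L(y, z)`. Frobenius' theorem (`Frobenius.exists_first_integral`) supplies a first integral `φ` of
`ker E`. In the coordinates `ψ = (φ, F₂)` the system reads `ξ̇₁ = g(ξ₁, ξ₂)`, `0 = ξ₂`; Hadamard's
lemma gives `g(ξ) = g(ξ₁, 0) + B(ξ) ξ₂`, and a row operation removes the last term
(`exists_normal_form`).

Frobenius is obtained by solving the equation along rays from `z = 0`. The integral equation is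
solved in the Banach space `C([0,1], Y)` by the inverse function theorem, so smooth dependence on
parameters reduces to smoothness of composition operators. Integrability and a Gronwall estimate
show that the ray solutions solve the full equation.

Convergence. In any Weierstrass chart, `Q E_ε = diag(I, -ε) Dψ`, so the perturbed system is `ξ̇₁ =
F*(ξ₁)`, `ε ξ̇₂ = -ξ₂`. By ODE uniqueness its `ξ₁` is that of the DAE solution started at the
projected point, while `ξ₂ = e^{-t/ε} ξ₂(0)` tends to zero for every `t > 0`; continuity of `ψ⁻¹`
concludes (`DAE.IsWeierstrassChart.tendsto_perturbed`). -/

/-! ### Composition operators and integration on spaces of continuous functions -/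

namespace ContinuousMap

section Composition

variable {K : Type} [TopologicalSpace K] [CompactSpace K]
variable {E F : Type} [NormedAddCommGroup E] [NormedSpace ℝ E]
  [NormedAddCommGroup F] [NormedSpace ℝ F]

/-- Pointwise evaluation of a continuous family of operators, as a bounded bilinear map. -/
noncomputable def clmApplyL : C(K, E →L[ℝ] F) →L[ℝ] C(K, E) →L[ℝ] C(K, F) :=
  LinearMap.mkContinuous₂
    (LinearMap.mk₂ ℝ
      (fun (A : C(K, E →L[ℝ] F)) (u : C(K, E)) => (⟨fun t => A t (u t), by fun_prop⟩ : C(K, F)))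
      (fun _ _ _ => by ext; simp) (fun _ _ _ => by ext; simp)
      (fun _ _ _ => by ext; simp) (fun _ _ _ => by ext; simp)) 1
    (fun A u => by
      rw [ContinuousMap.norm_le _ (by positivity)]
      intro t
      calc ‖A t (u t)‖ ≤ ‖A t‖ * ‖u t‖ := (A t).le_opNorm _
        _ ≤ 1 * ‖A‖ * ‖u‖ := by
          rw [one_mul]
          exact mul_le_mul (A.norm_coe_le_norm t) (u.norm_coe_le_norm t) (norm_nonneg _)
            (norm_nonneg A))

@[simp] theorem clmApplyL_apply (A : C(K, E →L[ℝ] F)) (u : C(K, E)) (t : K) :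
    clmApplyL A u t = A t (u t) := rfl

/-- The composition operator `u ↦ f ∘ u` has the derivative `h ↦ (f' ∘ u) h`. -/
theorem hasFDerivAt_comp_left (f : C(E, F)) (f' : C(E, E →L[ℝ] F))
    (hf : ∀ x, HasFDerivAt f (f' x) x) (u : C(K, E)) :
    HasFDerivAt (fun v : C(K, E) => f.comp v) (clmApplyL (f'.comp u)) u := by
  rw [hasFDerivAt_iff_isLittleO, Asymptotics.isLittleO_iff]
  intro c hc
  -- Continuity in the sup norm over the compact `K` makes `δ` uniform in `t`, with no local
  -- compactness of `E`.
  have hcont : Continuous fun v : C(K, E) => f'.comp v := ContinuousMap.continuous_postcomp f'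
  obtain ⟨δ, hδ, hδu⟩ := (Metric.continuous_iff (α := C(K, E))
    (β := C(K, E →L[ℝ] F))).1 hcont u c hc
  filter_upwards [Metric.ball_mem_nhds u hδ] with v hv
  rw [ContinuousMap.norm_le _ (by positivity)]
  intro t
  have key : ∀ x ∈ Metric.ball (u t) δ, ‖f' x - f' (u t)‖ ≤ c := by
    intro x hx
    -- The translate of `u` by a constant takes the value `x` at `t` and stays within `δ` of `u`,
    -- which turns sup-norm continuity into a pointwise bound.
    have hd : dist (u + const K (x - u t)) u < δ := by
      rw [dist_eq_norm, add_sub_cancel_left]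
      refine lt_of_le_of_lt ((ContinuousMap.norm_le _ (norm_nonneg (x - u t))).2 fun s => ?_)
        (by simpa [dist_eq_norm] using hx)
      simp
    have h1 := (dist_apply_le_dist (f := f'.comp (u + const K (x - u t))) (g := f'.comp u)
      t).trans (hδu _ hd).le
    simpa [dist_eq_norm] using h1
  have hvt : v t ∈ Metric.ball (u t) δ := lt_of_le_of_lt (dist_apply_le_dist t) hv
  have := Convex.norm_image_sub_le_of_norm_hasFDerivWithin_le' (f := f) (f' := f')
    (fun x _ => (hf x).hasFDerivWithinAt) key (convex_ball _ _) (Metric.mem_ball_self hδ) hvt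
  exact this.trans (mul_le_mul_of_nonneg_left ((v - u).norm_coe_le_norm t) hc.le)

/-- The derivative of a composition operator is the composition operator of `fderiv ℝ f` followed by
a bounded linear map, which permits induction on the order. `F` varies because the derivative takes
values in another space. -/
theorem contDiff_comp_left_nat (n : ℕ) : ∀ {F : Type} [NormedAddCommGroup F] [NormedSpace ℝ F]
    (f : C(E, F)), ContDiff ℝ n f → ContDiff ℝ n fun v : C(K, E) => f.comp v := by
  induction n with
  | zero =>
    intro F _ _ f _
    exact contDiff_zero.2 (ContinuousMap.continuous_postcomp f)
  | succ n ih =>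
    intro F _ _ f hf
    have hf' := contDiff_succ_iff_fderiv.1 (by exact_mod_cast hf : ContDiff ℝ ((n : ℕ∞ω) + 1) f)
    have hder := fun u => hasFDerivAt_comp_left (K := K) f
      ⟨fderiv ℝ f, hf'.2.2.continuous⟩ (fun x => (hf'.1 x).hasFDerivAt) u
    have : ContDiff ℝ ((n : ℕ∞ω) + 1) fun v : C(K, E) => f.comp v := by
      refine contDiff_succ_iff_fderiv.2 ⟨fun u => (hder u).differentiableAt, by simp, ?_⟩
      rw [show fderiv ℝ (fun v : C(K, E) => f.comp v) = fun u => clmApplyL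
        ((⟨fderiv ℝ f, hf'.2.2.continuous⟩ : C(E, E →L[ℝ] F)).comp u) from
        funext fun u => (hder u).fderiv]
      exact clmApplyL.contDiff.comp (ih ⟨fderiv ℝ f, hf'.2.2.continuous⟩ hf'.2.2)
    exact_mod_cast this

/-- Composition with a smooth map is a smooth operator on continuous functions. -/
theorem contDiff_comp_left (f : C(E, F)) (hf : ContDiff ℝ ∞ f) :
    ContDiff ℝ ∞ fun v : C(K, E) => f.comp v :=
  contDiff_infty.2 fun n => contDiff_comp_left_nat n f (contDiff_infty.1 hf n)

end Composition

section Integral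

variable {E : Type} [NormedAddCommGroup E]

/-- The extension of a function on the unit interval by constants. -/
noncomputable def extendUnit (u : C(unitInterval, E)) : ℝ → E :=
  IccExtend (zero_le_one' ℝ) u

theorem continuous_extendUnit (u : C(unitInterval, E)) : Continuous (extendUnit u) :=
  u.continuous.Icc_extend'

theorem extendUnit_of_mem (u : C(unitInterval, E)) {t : ℝ} (ht : t ∈ Icc (0 : ℝ) 1) :
    extendUnit u t = u ⟨t, ht⟩ := IccExtend_of_mem _ _ ht

theorem norm_extendUnit_le (u : C(unitInterval, E)) (t : ℝ) : ‖extendUnit u t‖ ≤ ‖u‖ :=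
  u.norm_coe_le_norm _

variable [NormedSpace ℝ E]

theorem hasDerivAt_integral_extendUnit [CompleteSpace E] (u : C(unitInterval, E)) (t : ℝ) :
    HasDerivAt (fun τ => ∫ σ in (0 : ℝ)..τ, extendUnit u σ) (extendUnit u t) t :=
  (continuous_extendUnit u).integral_hasStrictDerivAt 0 t |>.hasDerivAt

/-- The integration operator `u ↦ ∫₀ᵗ u` on continuous functions on the unit interval. -/
noncomputable def integralL [CompleteSpace E] : C(unitInterval, E) →L[ℝ] C(unitInterval, E) :=
  LinearMap.mkContinuous
    { toFun := fun u => ⟨fun t => ∫ σ in (0 : ℝ)..t, extendUnit u σ,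
        (continuous_iff_continuousAt.2 fun t =>
          (hasDerivAt_integral_extendUnit u t).continuousAt).comp continuous_subtype_val⟩
      map_add' := fun u v => by
        ext t
        exact intervalIntegral.integral_add ((continuous_extendUnit u).intervalIntegrable _ _)
          ((continuous_extendUnit v).intervalIntegrable _ _)
      map_smul' := fun c u => by
        ext t
        exact intervalIntegral.integral_smul c (extendUnit u) }
    1 (fun u => by
      rw [ContinuousMap.norm_le _ (by positivity)]
      intro t
      refine (intervalIntegral.norm_integral_le_of_norm_le_const
        (fun σ _ => norm_extendUnit_le u σ)).trans ?_
      rw [sub_zero, abs_of_nonneg t.2.1, one_mul]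
      exact mul_le_of_le_one_right (norm_nonneg _) t.2.2)

theorem integralL_apply [CompleteSpace E] (u : C(unitInterval, E)) (t : unitInterval) :
    integralL u t = ∫ σ in (0 : ℝ)..t, extendUnit u σ := rfl

theorem integralL_const [CompleteSpace E] (c : E) (t : unitInterval) :
    integralL (const unitInterval c) t = (t : ℝ) • c := by
  have : extendUnit (const unitInterval c) = fun _ => c := rfl
  simp [integralL_apply, this]

/-- The ray `t ↦ t • z`, depending linearly on `z`. -/
noncomputable def rayL : E →L[ℝ] C(unitInterval, E) :=
  LinearMap.mkContinuous
    { toFun := fun z => ⟨fun t => (t : ℝ) • z, by fun_prop⟩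
      map_add' := fun u v => by ext t; simp
      map_smul' := fun c u => by ext t; exact smul_comm _ _ _ }
    1 (fun z => by
      rw [ContinuousMap.norm_le _ (by positivity)]
      intro t
      simp only [LinearMap.coe_mk, AddHom.coe_mk, coe_mk, norm_smul, Real.norm_eq_abs,
        abs_of_nonneg t.2.1]
      exact mul_le_mul_of_nonneg_right t.2.2 (norm_nonneg _))

@[simp] theorem rayL_apply (z : E) (t : unitInterval) : rayL z t = (t : ℝ) • z := rfl

/-- Pairing of continuous functions, as a bounded linear map. -/
noncomputable def prodMkL {F : Type} [NormedAddCommGroup F] [NormedSpace ℝ F] :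
    C(unitInterval, E) × C(unitInterval, F) →L[ℝ] C(unitInterval, E × F) :=
  (ContinuousLinearMap.compLeftContinuous ℝ unitInterval (ContinuousLinearMap.inl ℝ E F)).coprod
    (ContinuousLinearMap.compLeftContinuous ℝ unitInterval (ContinuousLinearMap.inr ℝ E F))

@[simp] theorem prodMkL_apply {F : Type} [NormedAddCommGroup F] [NormedSpace ℝ F]
    (p : C(unitInterval, E) × C(unitInterval, F)) (t : unitInterval) :
    prodMkL p t = (p.1 t, p.2 t) := by
  simp [prodMkL]

end Integral

end ContinuousMap

/-! ### Smooth functions: Hadamard's lemma, globalization, local inverses -/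

section SmoothTools

variable {E F : Type} [NormedAddCommGroup E] [NormedSpace ℝ E]
  [NormedAddCommGroup F] [NormedSpace ℝ F]

/-- **Hadamard's lemma** with parameters. -/
theorem ContDiff.exists_eq_add_clm_apply {Y Z : Type} [NormedAddCommGroup Y] [NormedSpace ℝ Y]
    [NormedAddCommGroup Z] [NormedSpace ℝ Z] [CompleteSpace F] {g : Y × Z → F}
    (hg : ContDiff ℝ ∞ g) :
    ∃ B : Y × Z → Z →L[ℝ] F, ContDiff ℝ ∞ B ∧ ∀ p, g p = g (p.1, 0) + B p p.2 := by
  have hg' : ContDiff ℝ ∞ fun q => (fderiv ℝ g q).comp (ContinuousLinearMap.inr ℝ Y Z) :=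
    (hg.fderiv_right (m := ∞) (by simp)).clm_comp contDiff_const
  let D : C(Y × Z, Z →L[ℝ] F) := ⟨_, hg'.continuous⟩
  -- `J p` is the segment `t ↦ (p.1, t • p.2)`, linear in `p`. Hence `B`, the mean of `∂g/∂z` along
  -- it, is smooth without differentiating under an integral sign.
  let J : Y × Z →L[ℝ] C(unitInterval, Y × Z) := ContinuousMap.prodMkL.comp
    ((ContinuousLinearMap.const ℝ unitInterval).prodMap ContinuousMap.rayL)
  refine ⟨fun p => ContinuousMap.integralL (D.comp (J p)) 1, ?_, fun p => ?_⟩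
  · exact ((ContinuousMap.evalCLM ℝ (1 : unitInterval)).comp
      (ContinuousMap.integralL (E := Z →L[ℝ] F))).contDiff.comp
      ((ContinuousMap.contDiff_comp_left D hg').comp J.contDiff)
  · have hD : ∀ t ∈ uIcc (0 : ℝ) 1, HasDerivAt (fun t : ℝ => g (p.1, t • p.2))
        (ContinuousMap.extendUnit (D.comp (J p)) t p.2) t := by
      intro t ht
      rw [uIcc_of_le zero_le_one] at ht
      have h1 : HasDerivAt (fun t : ℝ => (p.1, t • p.2)) ((0 : Y), p.2) t := by
        have := ((hasDerivAt_id t).smul_const p.2)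
        exact (hasDerivAt_const t p.1).prodMk (by simpa using this)
      have h2 := ((hg.differentiable (by simp)) (p.1, t • p.2)).hasFDerivAt.comp_hasDerivAt t h1
      rw [ContinuousMap.extendUnit_of_mem _ ht]
      simpa [D, J, Function.comp_def] using h2
    have hint := intervalIntegral.integral_eq_sub_of_hasDerivAt hD
      (((ContinuousMap.continuous_extendUnit _).clm_apply
        continuous_const).intervalIntegrable _ _)
    rw [← ContinuousLinearMap.intervalIntegral_apply
      ((ContinuousMap.continuous_extendUnit _).intervalIntegrable _ _)] at hint
    simp only [one_smul, zero_smul, Prod.mk.eta] at hint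
    simp only [ContinuousMap.integralL_apply, Icc.coe_one, hint, add_sub_cancel]

/-- A function that is smooth near a point agrees near this point with a globally smooth one. -/
theorem ContDiffOn.exists_contDiff_eventuallyEq [FiniteDimensional ℝ E] {f : E → F} {O : Set E}
    {a : E} (hf : ContDiffOn ℝ ∞ f O) (hO : IsOpen O) (ha : a ∈ O) :
    ∃ g : E → F, ContDiff ℝ ∞ g ∧ g =ᶠ[𝓝 a] f := by
  obtain ⟨δ, hδ, hball⟩ := Metric.isOpen_iff.1 hO a ha
  -- The outer radius is less than `δ`, so the ball of radius `δ` and the open set where the cutoff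
  -- is seen to vanish cover the space.
  let χ : ContDiffBump a := ⟨δ / 3, δ / 2, by positivity, by linarith⟩
  refine ⟨fun x => χ x • f x, contDiff_iff_contDiffAt.2 fun x => ?_, ?_⟩
  · by_cases hx : x ∈ Metric.ball a δ
    · exact (χ.contDiff.contDiffAt).smul (hf.contDiffAt (hO.mem_nhds (hball hx)))
    · have hx' : x ∈ (Metric.closedBall a (δ / 2))ᶜ := by
        simp only [Metric.mem_ball, not_lt, mem_compl_iff, Metric.mem_closedBall, not_le] at hx ⊢
        linarith
      refine (contDiffAt_const (c := (0 : F))).congr_of_eventuallyEq ?_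
      filter_upwards [Metric.isClosed_closedBall.isOpen_compl.mem_nhds hx'] with y hy
      have : χ y = 0 := χ.zero_of_le_dist (by
        simp only [mem_compl_iff, Metric.mem_closedBall, not_le] at hy
        exact hy.le)
      simp [this]
  · filter_upwards [χ.eventuallyEq_one] with y hy
    simp [hy]

/-- **Inverse function theorem**, with an inverse that is smooth on its whole domain. -/
theorem ContDiffOn.exists_openPartialHomeomorph [CompleteSpace E] {f : E → F} {O : Set E} {a : E}
    (hf : ContDiffOn ℝ ∞ f O) (hO : IsOpen O) (ha : a ∈ O)
    (hinv : (fderiv ℝ f a).IsInvertible) :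
    ∃ ψ : OpenPartialHomeomorph E F, ⇑ψ = f ∧ a ∈ ψ.source ∧ ψ.source ⊆ O ∧
      (∀ x ∈ ψ.source, (fderiv ℝ f x).IsInvertible) ∧
      ContDiffOn ℝ ∞ ψ ψ.source ∧ ContDiffOn ℝ ∞ ψ.symm ψ.target := by
  obtain ⟨e, he⟩ := hinv
  have hfa : ContDiffAt ℝ ∞ f a := hf.contDiffAt (hO.mem_nhds ha)
  have hda : HasFDerivAt f (e : E →L[ℝ] F) a := by
    rw [he]; exact (hfa.differentiableAt (by simp)).hasFDerivAt
  let ψ₀ := hfa.toOpenPartialHomeomorph f hda (by simp)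
  have hψ₀ : ⇑ψ₀ = f := hfa.toOpenPartialHomeomorph_coe hda (by simp)
  -- Invertibility of the derivative is open; restricting to it makes the inverse smooth at every
  -- point of its domain, not merely at the image of `a`.
  let O' : Set E := O ∩ fderiv ℝ f ⁻¹' range ((↑) : (E ≃L[ℝ] F) → E →L[ℝ] F)
  have hO' : IsOpen O' :=
    (hf.continuousOn_fderiv_of_isOpen hO (by simp)).isOpen_inter_preimage hO
      ContinuousLinearEquiv.isOpen
  have hsource : (ψ₀.restrOpen O' hO').source = ψ₀.source ∩ O' := rfl
  have hcoe : ⇑(ψ₀.restrOpen O' hO') = f := hψ₀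
  refine ⟨ψ₀.restrOpen O' hO', hcoe, ⟨hfa.mem_toOpenPartialHomeomorph_source hda (by simp), ha,
    ⟨e, he⟩⟩, fun x hx => hx.2.1, fun x hx => hx.2.2, ?_, fun y hy => ?_⟩
  · rw [hcoe]
    exact hf.mono fun x hx => hx.2.1
  · have hx := (ψ₀.restrOpen O' hO').map_target hy
    obtain ⟨e', he'⟩ := hx.2.2
    have hfx : ContDiffAt ℝ ∞ f ((ψ₀.restrOpen O' hO').symm y) :=
      hf.contDiffAt (hO.mem_nhds hx.2.1)
    refine ((ψ₀.restrOpen O' hO').contDiffAt_symm hy (f₀' := e') ?_ ?_).contDiffWithinAt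
    · rw [he', hcoe]
      exact (hfx.differentiableAt (by simp)).hasFDerivAt
    · rw [hcoe]; exact hfx

end SmoothTools

/-! ### Frobenius' theorem for graphs -/

namespace Frobenius

open ContinuousMap

variable {Y Z : Type} [NormedAddCommGroup Y] [NormedSpace ℝ Y]
  [NormedAddCommGroup Z] [NormedSpace ℝ Z]

/-- The curve `t ↦ (y(t), t w, w)` as a linear function of `(y, w)`. -/
noncomputable def radialCurveL : C(unitInterval, Y) × Z →L[ℝ] C(unitInterval, Y × Z × Z) :=
  prodMkL.comp ((ContinuousLinearMap.id ℝ _).prodMap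
    (prodMkL.comp (rayL.prod (ContinuousLinearMap.const ℝ unitInterval))))

theorem radialCurveL_apply (p : C(unitInterval, Y) × Z) (t : unitInterval) :
    radialCurveL p t = (p.1 t, (t : ℝ) • p.2, p.2) := by
  simp [radialCurveL]

/-- The map `(y, z, w) ↦ L(y, z) w`. -/
noncomputable def uncurryField (L : C(Y × Z, Z →L[ℝ] Y)) : C(Y × Z × Z, Y) :=
  ⟨fun x => L (x.1, x.2.1) x.2.2, by fun_prop⟩

theorem hasFDerivAt_uncurryField {L : C(Y × Z, Z →L[ℝ] Y)} (hL : ContDiff ℝ ∞ L) (x : Y × Z × Z) :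
    HasFDerivAt (uncurryField L) (fderiv ℝ (uncurryField L) x) x ∧
      ∀ v, fderiv ℝ (uncurryField L) x v =
        fderiv ℝ L (x.1, x.2.1) (v.1, v.2.1) x.2.2 + L (x.1, x.2.1) v.2.2 := by
  let P : Y × Z × Z →L[ℝ] Y × Z := (ContinuousLinearMap.fst ℝ _ _).prod
    ((ContinuousLinearMap.fst ℝ _ _).comp (ContinuousLinearMap.snd ℝ _ _))
  let R : Y × Z × Z →L[ℝ] Z := (ContinuousLinearMap.snd ℝ _ _).comp (ContinuousLinearMap.snd ℝ _ _)
  have h1 : HasFDerivAt L (fderiv ℝ L (P x)) (P x) :=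
    (hL.differentiable (by simp) (P x)).hasFDerivAt
  have h2 : HasFDerivAt (uncurryField L) _ x := (h1.comp x P.hasFDerivAt).clm_apply R.hasFDerivAt
  refine ⟨h2.differentiableAt.hasFDerivAt, fun v => ?_⟩
  rw [h2.fderiv]
  simp [P, R, add_comm]

theorem contDiff_uncurryField {L : C(Y × Z, Z →L[ℝ] Y)} (hL : ContDiff ℝ ∞ L) :
    ContDiff ℝ ∞ (uncurryField L) :=
  (hL.comp (contDiff_fst.prodMk (contDiff_fst.comp contDiff_snd))).clm_apply
    (contDiff_snd.comp contDiff_snd)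

/-- The right-hand side `t ↦ L(y(t), t w) w` of the equation `∂y/∂z = L(y, z)` along the ray in the
direction `w`, as a function of `(y, w)`. -/
noncomputable def radialField (L : C(Y × Z, Z →L[ℝ] Y)) (p : C(unitInterval, Y) × Z) :
    C(unitInterval, Y) :=
  (uncurryField L).comp (radialCurveL p)

theorem radialField_apply (L : C(Y × Z, Z →L[ℝ] Y)) (p : C(unitInterval, Y) × Z)
    (t : unitInterval) : radialField L p t = L (p.1 t, (t : ℝ) • p.2) p.2 := by
  simp [radialField, uncurryField, radialCurveL_apply]

theorem contDiff_radialField (L : C(Y × Z, Z →L[ℝ] Y)) (hL : ContDiff ℝ ∞ L) :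
    ContDiff ℝ ∞ (radialField L) :=
  (contDiff_comp_left _ (contDiff_uncurryField hL)).comp (radialCurveL (Y := Y) (Z := Z)).contDiff

/-- The direction `w` enters both through the base point `t w` and as the argument of `L`; the
product rule gives one term for each. -/
theorem fderiv_radialField_apply (L : C(Y × Z, Z →L[ℝ] Y)) (hL : ContDiff ℝ ∞ L)
    (p v : C(unitInterval, Y) × Z) (t : unitInterval) :
    fderiv ℝ (radialField L) p v t =
      fderiv ℝ L (p.1 t, (t : ℝ) • p.2) (v.1 t, (t : ℝ) • v.2) p.2 +
        L (p.1 t, (t : ℝ) • p.2) v.2 := by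
  have hc := (contDiff_uncurryField hL).continuous_fderiv (by simp)
  have h : HasFDerivAt (radialField L)
      ((clmApplyL ((⟨fderiv ℝ (uncurryField L), hc⟩ : C(_, _)).comp (radialCurveL p))).comp
        radialCurveL) p :=
    (hasFDerivAt_comp_left (uncurryField L) ⟨fderiv ℝ (uncurryField L), hc⟩
      (fun x => (hasFDerivAt_uncurryField hL x).1) (radialCurveL p)).comp p
      (radialCurveL (Y := Y) (Z := Z)).hasFDerivAt
  rw [h.fderiv]
  simp [(hasFDerivAt_uncurryField hL _).2, radialCurveL_apply]

variable [CompleteSpace Y]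

/-- Solutions of `∂y/∂z = L(y, z)` along rays depend smoothly on the initial value and on the
direction of the ray. -/
theorem exists_radial_solution [CompleteSpace Z] (L : C(Y × Z, Z →L[ℝ] Y)) (hL : ContDiff ℝ ∞ L) :
    ∃ (O : Set (Y × Z)) (y : Y × Z → C(unitInterval, Y)), IsOpen O ∧ (0 : Y × Z) ∈ O ∧
      ContDiffOn ℝ ∞ y O ∧ y 0 = 0 ∧
      ∀ q ∈ O, y q = const unitInterval q.1 + integralL (radialField L (y q, q.2)) := by
  -- A zero of the second component of `G` is a solution of the integral equation with parameter
  -- `q.1`, so the solution is read off from `G⁻¹(q, 0)`. Small `w` replaces a short time interval.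
  let G : ((Y × Z) × C(unitInterval, Y)) → ((Y × Z) × C(unitInterval, Y)) := fun q =>
    (q.1, q.2 - (const unitInterval q.1.1 + integralL (radialField L (q.2, q.1.2))))
  let S : ((Y × Z) × C(unitInterval, Y)) →L[ℝ] C(unitInterval, Y) × Z :=
    (ContinuousLinearMap.snd ℝ _ _).prod
      ((ContinuousLinearMap.snd ℝ _ _).comp (ContinuousLinearMap.fst ℝ _ _))
  let R : ((Y × Z) × C(unitInterval, Y)) →L[ℝ] C(unitInterval, Y) :=
    (ContinuousLinearMap.const ℝ unitInterval).comp
      ((ContinuousLinearMap.fst ℝ _ _).comp (ContinuousLinearMap.fst ℝ _ _))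
  have hN := contDiff_radialField L hL
  have hG : ContDiff ℝ ∞ G := by
    refine contDiff_fst.prodMk (contDiff_snd.sub (R.contDiff.add ?_))
    exact (integralL (E := Y)).contDiff.comp (hN.comp S.contDiff)
  have hN0 : radialField L 0 = 0 := by
    ext t; simp [radialField_apply]
  have hG0 : G 0 = 0 := by
    have : radialField L ((0 : ((Y × Z) × C(unitInterval, Y))).2, (0 : ((Y × Z) × C(unitInterval, Y))).1.2) = 0 := hN0
    simp only [G, this]
    ext <;> simp
  let D : ((Y × Z) × C(unitInterval, Y)) →L[ℝ] C(unitInterval, Y) :=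
    R + (integralL (E := Y)).comp ((fderiv ℝ (radialField L) 0).comp S)
  -- For `w = 0` the radial field vanishes whatever the curve is. Thus `D` ignores the curve, the
  -- derivative of `G` is unipotent, and changing the sign of `D` inverts it.
  have hD : ∀ c, D (0, c) = 0 := by
    intro c
    have : fderiv ℝ (radialField L) 0 (S (0, c)) = 0 := by
      ext t
      have h0 : S (0, c) = (c, 0) := rfl
      simp [fderiv_radialField_apply L hL, h0]
    simp only [D, _root_.add_apply, ContinuousLinearMap.comp_apply, this, map_zero]
    exact add_zero _
  have hGd : HasFDerivAt G ((ContinuousLinearMap.fst ℝ _ _).prod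
      (ContinuousLinearMap.snd ℝ _ _ - D)) 0 := by
    have hN' : HasFDerivAt (radialField L) (fderiv ℝ (radialField L) 0) (S 0) := by
      rw [map_zero]
      exact (hN.differentiable (by simp) 0).hasFDerivAt
    exact hasFDerivAt_fst.prodMk (hasFDerivAt_snd.sub (R.hasFDerivAt.add
      ((integralL (E := Y)).hasFDerivAt.comp 0 (hN'.comp 0 S.hasFDerivAt))))
  have hsplit : ∀ v : ((Y × Z) × C(unitInterval, Y)), D v = D (v.1, 0) := fun v => by
    have : v = (v.1, 0) + (0, v.2) := by simp
    conv_lhs => rw [this, map_add, hD, add_zero]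
  have hinv : (fderiv ℝ G 0).IsInvertible := by
    rw [hGd.fderiv]
    refine ContinuousLinearMap.IsInvertible.of_inverse (g := (ContinuousLinearMap.fst ℝ _ _).prod
      (ContinuousLinearMap.snd ℝ _ _ + D)) ?_ ?_ <;>
    · refine ContinuousLinearMap.ext fun v => Prod.ext rfl ?_
      first
        | exact (congrArg (v.2 + D v - ·) ((hsplit (v.1, v.2 + D v)).trans (hsplit v).symm)).trans
            (add_sub_cancel_right _ _)
        | exact (congrArg (v.2 - D v + ·) ((hsplit (v.1, v.2 - D v)).trans (hsplit v).symm)).trans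
            (sub_add_cancel _ _)
  obtain ⟨ψ, hψ, h0, -, -, -, hsm⟩ :=
    hG.contDiffOn.exists_openPartialHomeomorph isOpen_univ (mem_univ (0 : ((Y × Z) × C(unitInterval, Y)))) hinv
  let ι : Y × Z →L[ℝ] ((Y × Z) × C(unitInterval, Y)) := ContinuousLinearMap.inl ℝ _ _
  have hι0 : ι 0 = G 0 := by rw [hG0, map_zero]
  refine ⟨ι ⁻¹' ψ.target, fun q => (ψ.symm (ι q)).2, ψ.open_target.preimage ι.continuous, ?_,
    contDiff_snd.comp_contDiffOn (hsm.comp ι.contDiff.contDiffOn fun q hq => hq), ?_, fun q hq => ?_⟩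
  · rw [mem_preimage, hι0, ← hψ]
    exact ψ.map_source h0
  · simp only [hι0]
    rw [← hψ, ψ.left_inv h0]
    rfl
  · have h1 : G (ψ.symm (ι q)) = ι q := by rw [← hψ, ψ.right_inv hq]
    have h2 : (ψ.symm (ι q)).1 = q := congrArg Prod.fst h1
    have h3 := congrArg Prod.snd h1
    simp only [G, h2] at h3
    exact sub_eq_zero.1 h3

/-- The derivative of the radial solution with respect to the initial value and the direction. -/
theorem fderiv_radial_solution {L : C(Y × Z, Z →L[ℝ] Y)} (hL : ContDiff ℝ ∞ L)
    {O : Set (Y × Z)} {y : Y × Z → C(unitInterval, Y)} (hO : IsOpen O) (hy : ContDiffOn ℝ ∞ y O)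
    (hsol : ∀ q ∈ O, y q = const unitInterval q.1 + integralL (radialField L (y q, q.2)))
    {q : Y × Z} (hq : q ∈ O) (v : Y × Z) :
    fderiv ℝ y q v = const unitInterval v.1 +
      integralL (fderiv ℝ (radialField L) (y q, q.2) (fderiv ℝ y q v, v.2)) := by
  have hyd : HasFDerivAt y (fderiv ℝ y q) q :=
    ((hy.contDiffAt (hO.mem_nhds hq)).differentiableAt (by simp)).hasFDerivAt
  have hN := ((contDiff_radialField L hL).differentiable (by simp) (y q, q.2)).hasFDerivAt
  have h1 : HasFDerivAt (fun q : Y × Z => (y q, q.2)) ((fderiv ℝ y q).prod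
    (ContinuousLinearMap.snd ℝ _ _)) q := hyd.prodMk hasFDerivAt_snd
  have h2 : HasFDerivAt (fun q : Y × Z =>
      const unitInterval q.1 + integralL (radialField L (y q, q.2)))
      ((ContinuousLinearMap.const ℝ unitInterval).comp (ContinuousLinearMap.fst ℝ _ _) +
        (integralL (E := Y)).comp ((fderiv ℝ (radialField L) (y q, q.2)).comp
          ((fderiv ℝ y q).prod (ContinuousLinearMap.snd ℝ _ _)))) q :=
    ((ContinuousLinearMap.const ℝ unitInterval :
      Y →L[ℝ] C(unitInterval, Y)).hasFDerivAt.comp q hasFDerivAt_fst).add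
      ((integralL (E := Y)).hasFDerivAt.comp q (hN.comp q h1 :))
  have h3 := (h2.congr_of_eventuallyEq
    (eventually_of_mem (hO.mem_nhds hq) hsol)).unique hyd
  conv_lhs => rw [← h3]
  rfl

/-- If `∂y/∂z = L(y, z)` is integrable along the radial solution, then the radial solution solves
it: its derivative in the direction `h` of the second variable is `t L(y(t), t w) h`. -/
theorem fderiv_radial_solution_inr {L : C(Y × Z, Z →L[ℝ] Y)} (hL : ContDiff ℝ ∞ L)
    {O : Set (Y × Z)} {y : Y × Z → C(unitInterval, Y)} (hO : IsOpen O) (hy : ContDiffOn ℝ ∞ y O)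
    (hsol : ∀ q ∈ O, y q = const unitInterval q.1 + integralL (radialField L (y q, q.2)))
    {q : Y × Z} (hq : q ∈ O)
    (hint : ∀ (t : unitInterval) (h k : Z), fderiv ℝ L (y q t, (t : ℝ) • q.2)
      (L (y q t, (t : ℝ) • q.2) h, h) k = fderiv ℝ L (y q t, (t : ℝ) • q.2)
        (L (y q t, (t : ℝ) • q.2) k, k) h) (h : Z) (t : unitInterval) :
    fderiv ℝ y q (0, h) t = (t : ℝ) • L (y q t, (t : ℝ) • q.2) h := by
  set η := fderiv ℝ y q (0, h) with hη
  set w := q.2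
  set m : C(unitInterval, Y) := fderiv ℝ (radialField L) (y q, w) (η, h) with hm
  have hηm : η = integralL m := by
    have := fderiv_radial_solution hL hO hy hsol hq (0, h)
    rw [← hη] at this
    rw [this, hm]
    exact zero_add _
  let c : ℝ → Y := fun t => q.1 + ∫ σ in (0 : ℝ)..t, extendUnit (radialField L (y q, w)) σ
  let H : ℝ → Y := fun t => ∫ σ in (0 : ℝ)..t, extendUnit m σ
  have hc : ∀ t, HasDerivAt c (extendUnit (radialField L (y q, w)) t) t := fun t =>
    (hasDerivAt_integral_extendUnit _ t).const_add _
  have hH : ∀ t, HasDerivAt H (extendUnit m t) t := fun t => hasDerivAt_integral_extendUnit _ t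
  have hcy : ∀ t : unitInterval, c t = y q t := fun t => by
    rw [hsol q hq]
    rfl
  have hHη : ∀ t : unitInterval, H t = η t := fun t => by
    rw [hηm]
    rfl
  let γ : ℝ → Y × Z := fun t => (c t, t • w)
  have hγ : ∀ t, HasDerivAt γ (extendUnit (radialField L (y q, w)) t, w) t := fun t => by
    have := (hasDerivAt_id t).smul_const w
    exact (hc t).prodMk (by simpa using this)
  have hLγ : ∀ t, HasDerivAt (fun t => L (γ t) h)
      (fderiv ℝ L (γ t) (extendUnit (radialField L (y q, w)) t, w) h) t := fun t => by
    have := ((hL.differentiable (by simp)) (γ t)).hasFDerivAt.comp_hasDerivAt t (hγ t)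
    simpa using this.clm_apply (hasDerivAt_const t h)
  -- The defect `k` vanishes at `0` and will satisfy the linear homogeneous equation `k' = DL(γ)(k,
  -- 0) w`; Gronwall then gives `k = 0` on the unit interval.
  let k : ℝ → Y := fun t => H t - t • L (γ t) h
  let k' : ℝ → Y := fun t => extendUnit m t -
    (t • fderiv ℝ L (γ t) (extendUnit (radialField L (y q, w)) t, w) h + L (γ t) h)
  have hk : ∀ t, HasDerivAt k (k' t) t := fun t => by
    have := (hH t).sub ((hasDerivAt_id t).smul (hLγ t))
    simp only [id, one_smul] at this
    exact this
  have hk' : ∀ t ∈ Icc (0 : ℝ) 1, k' t = fderiv ℝ L (γ t) (k t, 0) w := by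
    intro t ht
    have e1 : c t = y q ⟨t, ht⟩ := hcy ⟨t, ht⟩
    have e2 : H t = η ⟨t, ht⟩ := hHη ⟨t, ht⟩
    have e3 := hint ⟨t, ht⟩ h w
    simp only [k', k, extendUnit_of_mem _ ht, radialField_apply, hm, γ,
      fderiv_radialField_apply L hL, e1, e2]
    simp only at e3 ⊢
    -- Integrability exchanges the derivative of `L h` along the ray for the derivative of `L w` in
    -- the direction `(L h, h)`; the difference then involves only `k`.
    rw [← e3]
    have e4 : (η ⟨t, ht⟩ - t • L (y q ⟨t, ht⟩, t • w) h, (0 : Z)) =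
        (η ⟨t, ht⟩, t • h) - t • (L (y q ⟨t, ht⟩, t • w) h, h) := by simp
    rw [e4, map_sub, map_smul, _root_.sub_apply, _root_.smul_apply]
    abel
  have hγc : Continuous γ := continuous_iff_continuousAt.2 fun t => (hγ t).continuousAt
  obtain ⟨C, hC⟩ := isCompact_Icc.exists_bound_of_continuousOn
    (((hL.continuous_fderiv (by simp)).comp hγc).continuousOn (s := Icc (0 : ℝ) 1))
  have hzero := eq_zero_of_abs_deriv_le_mul_abs_self_of_eq_zero_right (f := k) (f' := k')
    (K := C * ‖w‖) (a := 0) (b := 1)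
    (fun t _ => (hk t).continuousAt.continuousWithinAt) (fun t _ => (hk t).hasDerivWithinAt)
    (by simp [k, H]) (fun t ht => by
      have ht' := Ico_subset_Icc_self ht
      rw [hk' t ht']
      calc ‖fderiv ℝ L (γ t) (k t, 0) w‖ ≤ ‖fderiv ℝ L (γ t)‖ * ‖(k t, (0 : Z))‖ * ‖w‖ :=
            ((fderiv ℝ L (γ t)) _).le_of_opNorm_le ((fderiv ℝ L (γ t)).le_opNorm _) w
        _ = ‖fderiv ℝ L (γ t)‖ * ‖w‖ * ‖k t‖ := by simp [Prod.norm_def]; ring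
        _ ≤ C * ‖w‖ * ‖k t‖ := by
            gcongr
            exact hC t ht') t t.2
  have := sub_eq_zero.1 hzero
  rw [hHη] at this
  rw [this]
  simp only [γ, hcy]

/-- **Frobenius' theorem** for the distribution spanned by the graphs of `L(x) : Z → Y`: near `0` it
is the kernel of the derivative of a smooth map into `Y`. -/
theorem exists_first_integral [CompleteSpace Z] {L : Y × Z → Z →L[ℝ] Y} (hL : ContDiff ℝ ∞ L)
    (hint : ∀ᶠ x in 𝓝 (0 : Y × Z), ∀ h k : Z,
      fderiv ℝ L x (L x h, h) k = fderiv ℝ L x (L x k, k) h) :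
    ∃ (O : Set (Y × Z)) (φ : Y × Z → Y), IsOpen O ∧ (0 : Y × Z) ∈ O ∧ ContDiffOn ℝ ∞ φ O ∧
      φ 0 = 0 ∧ (∀ x ∈ O, ∀ h, fderiv ℝ φ x (L x h, h) = 0) ∧
      ∀ v, fderiv ℝ φ 0 v = v.1 - L 0 v.2 := by
  let Lc : C(Y × Z, Z →L[ℝ] Y) := ⟨L, hL.continuous⟩
  obtain ⟨O₁, y, hO₁, h0, hy, hy0, hsol⟩ := exists_radial_solution Lc hL
  obtain ⟨O₂, hO₂sub, hO₂, h0'⟩ := eventually_nhds_iff.1 hint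
  -- Integrability is needed along the whole ray solution. By compactness of the unit interval,
  -- curves that stay inside `O₂` form an open set.
  let T : Set (C(unitInterval, Y × Z)) := {u | MapsTo u univ O₂}
  have hT : IsOpen T := ContinuousMap.isOpen_setOfPred_mapsTo isCompact_univ hO₂
  let R : C(unitInterval, Y) × Z →L[ℝ] C(unitInterval, Y × Z) :=
    prodMkL.comp ((ContinuousLinearMap.id ℝ _).prodMap rayL)
  let g : Y × Z → C(unitInterval, Y × Z) := fun q => R (y q, q.2)
  have hgO : ContinuousOn g O₁ :=
    R.continuous.comp_continuousOn (hy.continuousOn.prodMk continuousOn_snd)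
  let O₃ : Set (Y × Z) := O₁ ∩ g ⁻¹' T
  have hO₃ : IsOpen O₃ := hgO.isOpen_inter_preimage hO₁ hT
  have h03 : (0 : Y × Z) ∈ O₃ := by
    refine ⟨h0, fun t _ => ?_⟩
    have : g 0 = 0 := by
      change R (y 0, 0) = 0
      rw [hy0]
      exact map_zero _
    rw [this]
    exact h0'
  -- `Φ` transports an initial value on `z = 0` along its leaf to height `w`. The first component of
  -- `Φ⁻¹` recovers the initial value, which is constant on leaves: this is `φ`.
  let Φ : Y × Z → Y × Z := fun q => (y q 1, q.2)
  have hΦ : ContDiffOn ℝ ∞ Φ O₃ :=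
    ((ContinuousMap.evalCLM ℝ (1 : unitInterval) : C(unitInterval, Y) →L[ℝ] Y).contDiff.comp_contDiffOn
      (hy.mono inter_subset_left)).prodMk contDiffOn_snd
  have hΦd : ∀ q ∈ O₃, HasFDerivAt Φ (((ContinuousMap.evalCLM ℝ (1 : unitInterval)).comp
      (fderiv ℝ y q)).prod (ContinuousLinearMap.snd ℝ _ _)) q := fun q hq =>
    ((ContinuousMap.evalCLM ℝ (1 : unitInterval) : C(unitInterval, Y) →L[ℝ] Y).hasFDerivAt.comp q
      ((hy.contDiffAt (hO₁.mem_nhds hq.1)).differentiableAt (by simp)).hasFDerivAt).prodMk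
        hasFDerivAt_snd
  have hΦ0 : Φ 0 = 0 := by simp [Φ, hy0]
  have hΦd0 : ∀ v, fderiv ℝ Φ 0 v = (v.1 + L 0 v.2, v.2) := by
    intro v
    rw [(hΦd 0 h03).fderiv]
    have h1 := fderiv_radial_solution hL hO₁ hy hsol h0 v
    have h2 : fderiv ℝ (radialField Lc) (y 0, (0 : Y × Z).2) (fderiv ℝ y 0 v, v.2) =
        const unitInterval (L 0 v.2) := by
      ext t
      rw [fderiv_radialField_apply Lc hL]
      have h00 : ((0 : Y), (0 : Z)) = 0 := rfl
      simp [hy0, Lc, h00]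
    rw [h2] at h1
    simp only [ContinuousLinearMap.prod_apply, ContinuousLinearMap.comp_apply,
      ContinuousMap.evalCLM_apply, ContinuousLinearMap.coe_snd']
    rw [h1]
    simp [integralL_const]
  have hinv : (fderiv ℝ Φ 0).IsInvertible := by
    refine ContinuousLinearMap.IsInvertible.of_inverse
      (g := (ContinuousLinearMap.fst ℝ Y Z - (L 0).comp (ContinuousLinearMap.snd ℝ Y Z)).prod
        (ContinuousLinearMap.snd ℝ Y Z)) ?_ ?_ <;>
    · refine ContinuousLinearMap.ext fun v => ?_
      simp [hΦd0]
  obtain ⟨ψ, hψ, h0ψ, hψO, hψinv, -, hsm⟩ := hΦ.exists_openPartialHomeomorph hO₃ h03 hinv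
  have hφd : ∀ x ∈ ψ.target, ∀ v,
      fderiv ℝ (fun x => (ψ.symm x).1) x (fderiv ℝ Φ (ψ.symm x) v) = v.1 := by
    intro x hx v
    have hq := ψ.map_target hx
    have h1 : HasFDerivAt ψ.symm (fderiv ℝ ψ.symm x) x :=
      ((hsm.contDiffAt (ψ.open_target.mem_nhds hx)).differentiableAt (by simp)).hasFDerivAt
    have h2 : HasFDerivAt Φ (fderiv ℝ Φ (ψ.symm x)) (ψ.symm x) :=
      (hΦd _ (hψO hq)).differentiableAt.hasFDerivAt
    have h1' : HasFDerivAt ψ.symm (fderiv ℝ ψ.symm x) (Φ (ψ.symm x)) := by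
      rwa [← hψ, ψ.right_inv hx]
    have h3 : HasFDerivAt (fun q => ψ.symm (Φ q)) (ContinuousLinearMap.id ℝ _) (ψ.symm x) :=
      (hasFDerivAt_id _).congr_of_eventuallyEq (by
        filter_upwards [ψ.open_source.mem_nhds hq] with q hq
        rw [← hψ]
        exact ψ.left_inv hq)
    have h4 := congrArg (fun A => (A v).1) ((h1'.comp _ h2).unique h3)
    have h5 : HasFDerivAt (fun x => (ψ.symm x).1)
      ((ContinuousLinearMap.fst ℝ Y Z).comp (fderiv ℝ ψ.symm x)) x := hasFDerivAt_fst.comp x h1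
    rw [h5.fderiv]
    simpa using h4
  have h0t : (0 : Y × Z) ∈ ψ.target := by
    rw [← hΦ0, ← hψ]
    exact ψ.map_source h0ψ
  have hs0 : ψ.symm 0 = 0 := by
    conv_lhs => rw [← hΦ0, ← hψ]
    exact ψ.left_inv h0ψ
  refine ⟨ψ.target, fun x => (ψ.symm x).1, ψ.open_target, h0t, contDiff_fst.comp_contDiffOn hsm,
    by simp [hs0], fun x hx h => ?_, fun v => ?_⟩
  · have hq := hψO (ψ.map_target hx)
    have hx' : Φ (ψ.symm x) = x := by rw [← hψ]; exact ψ.right_inv hx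
    -- At `t = 1` the derivative of `Φ` sends `(0, h)` to `(L x h, h)`, so the derivative of `φ`
    -- kills the graph of `L x`.
    have h1 := fderiv_radial_solution_inr hL hO₁ hy hsol hq.1 (fun t h k => by
      have ht : g (ψ.symm x) t ∈ O₂ := hq.2 (mem_univ t)
      have hgt : g (ψ.symm x) t = (y (ψ.symm x) t, (t : ℝ) • (ψ.symm x).2) := by
        simp [g, R]
      rw [hgt] at ht
      exact hO₂sub _ ht h k) h 1
    have h2 := hφd x hx (0, h)
    rw [(hΦd _ hq).fderiv] at h2
    simp only [ContinuousLinearMap.prod_apply, ContinuousLinearMap.comp_apply,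
      ContinuousMap.evalCLM_apply, ContinuousLinearMap.coe_snd', h1] at h2
    have h3 : (y (ψ.symm x) 1, (ψ.symm x).2) = x := hx'
    simpa [Lc, h3] using h2
  · have h1 := hφd 0 h0t (v.1 - L 0 v.2, v.2)
    rw [hs0, hΦd0] at h1
    simpa using h1

end Frobenius

/-! ### Local normal form of a semi-explicit system -/

section NormalForm

variable {E F : Type} [NormedAddCommGroup E] [NormedSpace ℝ E]
  [NormedAddCommGroup F] [NormedSpace ℝ F]

theorem ContinuousOn.isOpen_inter_isInvertible {X : Type} [TopologicalSpace X] [CompleteSpace E]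
    {A : X → E →L[ℝ] F} {O : Set X} (hA : ContinuousOn A O) (hO : IsOpen O) :
    IsOpen (O ∩ {x | (A x).IsInvertible}) :=
  hA.isOpen_inter_preimage hO ContinuousLinearEquiv.isOpen

theorem ContDiffOn.clm_inverse {X : Type} [NormedAddCommGroup X] [NormedSpace ℝ X]
    [CompleteSpace E] {A : X → E →L[ℝ] F} {O : Set X} (hA : ContDiffOn ℝ ∞ A O)
    (hinv : ∀ x ∈ O, (A x).IsInvertible) : ContDiffOn ℝ ∞ (fun x => (A x).inverse) O := by
  intro x hx
  obtain ⟨e, he⟩ := hinv x hx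
  have h := contDiffAt_map_inverse (𝕜 := ℝ) (n := ∞) e
  rw [he] at h
  exact h.comp_contDiffWithinAt x (hA x hx)

/-- The graph form `L(x) = -(∂e/∂y)⁻¹ (∂e/∂z)` of the kernel of a partial map is integrable if the
kernel is involutive. -/
theorem fderiv_symmetric_of_involutive {Y Z : Type} [NormedAddCommGroup Y] [NormedSpace ℝ Y]
    [NormedAddCommGroup Z] [NormedSpace ℝ Z] {e : Y × Z → Y × Z →L[ℝ] Y} {L : Y × Z → Z →L[ℝ] Y}
    {N : Set (Y × Z)} (hL : ContDiff ℝ ∞ L)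
    (hinj : ∀ x ∈ N, ∀ b, e x (b, 0) = 0 → b = 0)
    (hker : ∀ x ∈ N, ∀ h, e x (L x h, h) = 0)
    (hinv : ∀ f g : Y × Z → Y × Z, ContDiffOn ℝ ∞ f N → ContDiffOn ℝ ∞ g N →
      (∀ x ∈ N, e x (f x) = 0) → (∀ x ∈ N, e x (g x) = 0) →
      ∀ x ∈ N, e x (VectorField.lieBracket ℝ f g x) = 0) {x : Y × Z} (hx : x ∈ N) (h k : Z) :
    fderiv ℝ L x (L x h, h) k = fderiv ℝ L x (L x k, k) h := by
  -- These sections have constant `Z`-component, so their bracket has the form `(b, 0)`.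
  -- Involutivity puts it in `ker e`, and `hinj` makes `b` vanish.
  have hf : ∀ h : Z, ContDiff ℝ ∞ fun x => (L x h, h) := fun h =>
    (hL.clm_apply contDiff_const).prodMk contDiff_const
  have hd : ∀ (h : Z) (v : Y × Z), fderiv ℝ (fun x => (L x h, h)) x v = (fderiv ℝ L x v h, 0) := by
    intro h v
    have h1 : HasFDerivAt (fun x => (L x h, h)) _ x :=
      ((((hL.differentiable (by simp)) x).hasFDerivAt).clm_apply
        (hasFDerivAt_const h x)).prodMk (hasFDerivAt_const h x)
    rw [h1.fderiv]
    simp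
  have h1 := hinv _ _ (hf h).contDiffOn (hf k).contDiffOn (fun x hx => hker x hx h)
    (fun x hx => hker x hx k) x hx
  rw [VectorField.lieBracket, hd, hd, Prod.mk_sub_mk, sub_zero] at h1
  exact sub_eq_zero.1 (hinj x hx _ h1)

variable {Y Z : Type} [NormedAddCommGroup Y] [NormedSpace ℝ Y]
  [NormedAddCommGroup Z] [NormedSpace ℝ Z] [FiniteDimensional ℝ Y] [FiniteDimensional ℝ Z]

/-- Rectification: if `ker e` is involutive and `∂f₂/∂z` is regular, then in the coordinates
`ψ = (φ, f₂)` given by a first integral `φ` of `ker e` the equation `e ẋ = f₁` reads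
`ξ̇₁ = C f₁` for an invertible `C`. -/
theorem exists_rectifying_coordinates {O : Set (Y × Z)} (hO : IsOpen O) (h0 : (0 : Y × Z) ∈ O)
    {e : Y × Z → Y × Z →L[ℝ] Y} {f₂ : Y × Z → Z} (he : ContDiffOn ℝ ∞ e O)
    (hf₂ : ContDiffOn ℝ ∞ f₂ O) (he0 : e 0 = ContinuousLinearMap.fst ℝ Y Z) (hf0 : f₂ 0 = 0)
    (hdf0 : fderiv ℝ f₂ 0 = ContinuousLinearMap.snd ℝ Y Z)
    (hinv : ∀ W : Set (Y × Z), IsOpen W → W ⊆ O → ∀ f g : Y × Z → Y × Z, ContDiffOn ℝ ∞ f W →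
      ContDiffOn ℝ ∞ g W → (∀ x ∈ W, e x (f x) = 0) → (∀ x ∈ W, e x (g x) = 0) →
      ∀ x ∈ W, e x (VectorField.lieBracket ℝ f g x) = 0) :
    ∃ (ψ : OpenPartialHomeomorph (Y × Z) (Y × Z)) (C : Y × Z → Y →L[ℝ] Y),
      (0 : Y × Z) ∈ ψ.source ∧ ψ.source ⊆ O ∧ ψ 0 = 0 ∧
      ContDiffOn ℝ ∞ ψ ψ.source ∧ ContDiffOn ℝ ∞ ψ.symm ψ.target ∧
      ContDiffOn ℝ ∞ C ψ.source ∧ (∀ x ∈ ψ.source, (C x).IsInvertible) ∧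
      (∀ x ∈ ψ.source, ∀ v, C x (e x v) = (fderiv ℝ ψ x v).1) ∧
      ∀ x ∈ ψ.source, (ψ x).2 = f₂ x := by
  have := FiniteDimensional.complete ℝ Y
  have := FiniteDimensional.complete ℝ Z
  let A : Y × Z → Y →L[ℝ] Y := fun x => (e x).comp (ContinuousLinearMap.inl ℝ Y Z)
  have hA : ContDiffOn ℝ ∞ A O := he.clm_comp contDiffOn_const
  have hA0 : A 0 = ContinuousLinearMap.id ℝ Y := by ext; simp [A, he0]
  let O₁ := O ∩ {x | (A x).IsInvertible}
  have hO₁ : IsOpen O₁ := ContinuousOn.isOpen_inter_isInvertible hA.continuousOn hO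
  have h01 : (0 : Y × Z) ∈ O₁ := ⟨h0, by
    rw [mem_ofPred_eq, hA0]; exact ⟨ContinuousLinearEquiv.refl ℝ Y, rfl⟩⟩
  have hAi : ContDiffOn ℝ ∞ (fun x => (A x).inverse) O₁ :=
    (hA.mono inter_subset_left).clm_inverse fun x hx => hx.2
  let L₀ : Y × Z → Z →L[ℝ] Y := fun x =>
    -((A x).inverse.comp ((e x).comp (ContinuousLinearMap.inr ℝ Y Z)))
  have hL₀ : ContDiffOn ℝ ∞ L₀ O₁ :=
    (hAi.clm_comp ((he.mono inter_subset_left).clm_comp contDiffOn_const)).neg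
  have heA : ∀ x b h, e x (b, h) = A x b + e x (0, h) := fun x b h => by
    simp only [A, ContinuousLinearMap.comp_apply, ContinuousLinearMap.inl_apply, ← map_add]
    simp
  -- The radial construction composes `L` with arbitrary curves, hence needs a globally smooth `L`;
  -- only the germ of `L₀` at `0` matters.
  obtain ⟨L, hL, hLL₀⟩ := hL₀.exists_contDiff_eventuallyEq hO₁ h01
  obtain ⟨N', hN'sub, hN', h0N'⟩ := eventually_nhds_iff.1 hLL₀
  let N := N' ∩ O₁
  have hN : IsOpen N := hN'.inter hO₁
  have h0N : (0 : Y × Z) ∈ N := ⟨h0N', h01⟩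
  have hker : ∀ x ∈ N, ∀ h, e x (L x h, h) = 0 := by
    intro x hx h
    rw [heA, hN'sub x hx.1]
    simp [L₀, hx.2.2.self_apply_inverse]
  have hinj : ∀ x ∈ N, ∀ b, e x (b, 0) = 0 → b = 0 := fun x hx b hb =>
    hx.2.2.injective (hb.trans (map_zero _).symm)
  obtain ⟨Oφ, φ, hOφ, h0φ, hφ, hφ0, hφker, hφd0⟩ := Frobenius.exists_first_integral hL
    (eventually_of_mem (hN.mem_nhds h0N) fun x hx h k =>
      fderiv_symmetric_of_involutive hL hinj hker
        (hinv N hN fun x hx => hx.2.1) hx h k)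
  let O₂ := N ∩ Oφ
  have hO₂ : IsOpen O₂ := hN.inter hOφ
  -- The derivative of `φ` kills `ker e`, so it factors as `C e`; evaluating on vectors `(b, 0)`,
  -- which complement the graph of `L`, determines `C`.
  let C : Y × Z → Y →L[ℝ] Y := fun x =>
    ((fderiv ℝ φ x).comp (ContinuousLinearMap.inl ℝ Y Z)).comp (A x).inverse
  have hC : ContDiffOn ℝ ∞ C O₂ :=
    (((hφ.fderiv_of_isOpen hOφ (m := ∞) (by simp)).mono inter_subset_right).clm_comp
      contDiffOn_const).clm_comp (hAi.mono fun x hx => hx.1.2)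
  have hL0 : L 0 = 0 := by
    rw [hN'sub 0 h0N']
    ext; simp [L₀, he0]
  have hC0 : C 0 = ContinuousLinearMap.id ℝ Y := by
    ext b
    simp [C, hA0, hφd0]
  let O₃ := O₂ ∩ {x | (C x).IsInvertible}
  have hO₃ : IsOpen O₃ := ContinuousOn.isOpen_inter_isInvertible hC.continuousOn hO₂
  have h03 : (0 : Y × Z) ∈ O₃ := ⟨⟨h0N, h0φ⟩, by
    rw [mem_ofPred_eq, hC0]; exact ⟨ContinuousLinearEquiv.refl ℝ Y, rfl⟩⟩
  have hφ' : ∀ x ∈ O₃, HasFDerivAt φ (fderiv ℝ φ x) x := fun x hx =>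
    ((hφ.contDiffAt (hOφ.mem_nhds hx.1.2)).differentiableAt (by simp)).hasFDerivAt
  have hf₂' : ∀ x ∈ O₃, HasFDerivAt f₂ (fderiv ℝ f₂ x) x := fun x hx =>
    ((hf₂.contDiffAt (hO.mem_nhds hx.1.1.2.1)).differentiableAt (by simp)).hasFDerivAt
  let Ψ : Y × Z → Y × Z := fun x => (φ x, f₂ x)
  have hΨd : ∀ x ∈ O₃, HasFDerivAt Ψ ((fderiv ℝ φ x).prod (fderiv ℝ f₂ x)) x := fun x hx =>
    (hφ' x hx).prodMk (hf₂' x hx)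
  have hΨ : ContDiffOn ℝ ∞ Ψ O₃ :=
    (hφ.mono fun x hx => hx.1.2).prodMk (hf₂.mono fun x hx => hx.1.1.2.1)
  obtain ⟨ψ, hψ, h0ψ, hψO, -, hψs, hψsymm⟩ := hΨ.exists_openPartialHomeomorph hO₃ h03 (by
    rw [(hΨd 0 h03).fderiv]
    refine ⟨ContinuousLinearEquiv.refl ℝ _, ContinuousLinearMap.ext fun v => ?_⟩
    simp [hφd0, hdf0, hL0])
  refine ⟨ψ, C, h0ψ, fun x hx => (hψO hx).1.1.2.1, by simp [hψ, Ψ, hφ0, hf0], hψs, hψsymm,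
    hC.mono fun x hx => (hψO hx).1, fun x hx => (hψO hx).2, fun x hx v => ?_, fun x _ => by
      rw [hψ]⟩
  have hx3 := hψO hx
  rw [hψ, (hΨd x hx3).fderiv]
  have h1 : e x v = A x (v.1 - L x v.2) := by
    have h2 : v = (v.1 - L x v.2, 0) + (L x v.2, v.2) := by simp
    conv_lhs => rw [h2, map_add, hker x hx3.1.1, add_zero]
    rfl
  have h3 : fderiv ℝ φ x v = fderiv ℝ φ x (v.1 - L x v.2, 0) := by
    have h2 : v = (v.1 - L x v.2, 0) + (L x v.2, v.2) := by simp
    conv_lhs => rw [h2, map_add, hφker x hx3.1.2, add_zero]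
  simp only [C, ContinuousLinearMap.comp_apply, h1, ContinuousLinearMap.prod_apply, h3,
    (hx3.1.1.2.2).inverse_apply_self, ContinuousLinearMap.inl_apply]

/-- Local normal form of the semi-explicit system `e ẋ = f₁`, `0 = f₂` with an involutive kernel
`ker e` and regular `∂f₂/∂z`. -/
theorem exists_normal_form {O : Set (Y × Z)} (hO : IsOpen O) (h0 : (0 : Y × Z) ∈ O)
    {e : Y × Z → Y × Z →L[ℝ] Y} {f₁ : Y × Z → Y} {f₂ : Y × Z → Z} (he : ContDiffOn ℝ ∞ e O)
    (hf₁ : ContDiffOn ℝ ∞ f₁ O)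
    (hf₂ : ContDiffOn ℝ ∞ f₂ O) (he0 : e 0 = ContinuousLinearMap.fst ℝ Y Z) (hf0 : f₂ 0 = 0)
    (hdf0 : fderiv ℝ f₂ 0 = ContinuousLinearMap.snd ℝ Y Z)
    (hinv : ∀ W : Set (Y × Z), IsOpen W → W ⊆ O → ∀ f g : Y × Z → Y × Z, ContDiffOn ℝ ∞ f W →
      ContDiffOn ℝ ∞ g W → (∀ x ∈ W, e x (f x) = 0) → (∀ x ∈ W, e x (g x) = 0) →
      ∀ x ∈ W, e x (VectorField.lieBracket ℝ f g x) = 0) :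
    ∃ (ψ : OpenPartialHomeomorph (Y × Z) (Y × Z)) (X₁ : Set Y) (X₂ : Set Z)
      (Q : Y × Z → Y × Z →L[ℝ] Y × Z) (Fstar : Y → Y),
      (0 : Y × Z) ∈ ψ.source ∧ ψ.source ⊆ O ∧ IsOpen X₁ ∧ IsOpen X₂ ∧ ψ.target = X₁ ×ˢ X₂ ∧
      ContDiffOn ℝ ∞ ψ ψ.source ∧ ContDiffOn ℝ ∞ ψ.symm ψ.target ∧
      ContDiffOn ℝ ∞ Q ψ.source ∧ ContDiff ℝ ∞ Fstar ∧ (∀ x ∈ ψ.source, (Q x).IsInvertible) ∧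
      (∀ x ∈ ψ.source, ∀ v, Q x (e x v, 0) = ((fderiv ℝ ψ x v).1, 0)) ∧
      ∀ x ∈ ψ.source, Q x (f₁ x, f₂ x) = (Fstar (ψ x).1, (ψ x).2) := by
  have := FiniteDimensional.complete ℝ Y
  obtain ⟨ψ, C, h0ψ, hψO, hψ0, hψs, hψsymm, hC, hCinv, hCe, hψ2⟩ :=
    exists_rectifying_coordinates hO h0 he hf₂ he0 hf0 hdf0 hinv
  have hG : ContDiffOn ℝ ∞ (fun ξ => C (ψ.symm ξ) (f₁ (ψ.symm ξ))) ψ.target :=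
    (hC.comp hψsymm fun ξ hξ => ψ.map_target hξ).clm_apply
      (hf₁.comp hψsymm fun ξ hξ => hψO (ψ.map_target hξ))
  have h0t : (0 : Y × Z) ∈ ψ.target := by
    rw [← hψ0]
    exact ψ.map_source h0ψ
  obtain ⟨g, hg, hgG⟩ := hG.exists_contDiff_eventuallyEq ψ.open_target h0t
  -- The remaining dependence of the right-hand side on `ξ₂` is `B ξ₂`. Since `ξ₂ = f₂` is the
  -- algebraic row, `Q` subtracts `B` times that row, which does not disturb the left-hand side.
  obtain ⟨B, hB, hgB⟩ := hg.exists_eq_add_clm_apply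
  -- Balls for the sup norm of a product are products of balls, so shrinking the target to a ball
  -- yields the required form `X₁ ×ˢ X₂`.
  obtain ⟨δ, hδ, hball⟩ := Metric.mem_nhds_iff.1 (inter_mem hgG (ψ.open_target.mem_nhds h0t))
  let ψ' := (ψ.symm.restrOpen (Metric.ball 0 δ) Metric.isOpen_ball).symm
  have hcoe : ⇑ψ' = ψ := rfl
  have hsymm : ⇑ψ'.symm = ψ.symm := rfl
  have htarget : ψ'.target = ψ.target ∩ Metric.ball 0 δ := rfl
  have htarget' : ψ'.target = Metric.ball 0 δ := by
    rw [htarget, inter_eq_right]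
    exact fun ξ hξ => (hball hξ).2
  have hsource : ψ'.source ⊆ ψ.source := fun x hx => by
    have h1 := ψ'.map_source hx
    rw [← ψ'.left_inv hx]
    exact ψ.map_target h1.1
  have hmem : ∀ x ∈ ψ'.source, ψ x ∈ Metric.ball (0 : Y × Z) δ := fun x hx => by
    rw [← htarget']
    exact ψ'.map_source hx
  refine ⟨ψ', Metric.ball 0 δ, Metric.ball 0 δ, fun x =>
    ((C x).comp (ContinuousLinearMap.fst ℝ Y Z) -
      (B (ψ x)).comp (ContinuousLinearMap.snd ℝ Y Z)).prod (ContinuousLinearMap.snd ℝ Y Z),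
    fun y => g (y, 0), ?_, hsource.trans hψO, Metric.isOpen_ball, Metric.isOpen_ball, ?_,
    hψs.mono hsource, hψsymm.mono inter_subset_left, ?_,
    hg.comp (contDiff_id.prodMk contDiff_const), fun x hx => ?_, fun x hx v => ?_, fun x hx => ?_⟩
  · have h1 : (0 : Y × Z) ∈ ψ'.target := by
      rw [htarget']
      exact Metric.mem_ball_self hδ
    have h2 := ψ'.map_target h1
    have h3 : ψ'.symm 0 = 0 := by
      rw [hsymm]
      conv_lhs => rw [← hψ0]
      exact ψ.left_inv h0ψ
    rwa [h3] at h2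
  · rw [htarget', ball_prod_same]
    rfl
  · have h1 : ContDiffOn ℝ ∞ (fun x => (C x).comp (ContinuousLinearMap.fst ℝ Y Z) -
        (B (ψ x)).comp (ContinuousLinearMap.snd ℝ Y Z)) ψ'.source :=
      ((hC.mono hsource).clm_comp contDiffOn_const).sub
        ((hB.comp_contDiffOn (hψs.mono hsource)).clm_comp contDiffOn_const)
    have h2 : ContDiffOn ℝ ∞ (fun _ : Y × Z => ContinuousLinearMap.snd ℝ Y Z) ψ'.source :=
      contDiffOn_const
    exact (ContinuousLinearMap.prodₗᵢ (𝕜 := ℝ) (E := Y × Z) (F := Y) (G := Z)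
      ℝ).toContinuousLinearEquiv.contDiff.comp_contDiffOn (h1.prodMk h2)
  · have hx' := hCinv x (hsource hx)
    refine ContinuousLinearMap.IsInvertible.of_inverse
      (g := ((C x).inverse.comp (ContinuousLinearMap.fst ℝ Y Z +
        (B (ψ x)).comp (ContinuousLinearMap.snd ℝ Y Z))).prod (ContinuousLinearMap.snd ℝ Y Z))
      ?_ ?_ <;> refine ContinuousLinearMap.ext fun v => ?_ <;>
      simp only [ContinuousLinearMap.comp_apply, ContinuousLinearMap.prod_apply,
        ContinuousLinearMap.coe_fst', ContinuousLinearMap.coe_snd', _root_.sub_apply,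
        _root_.add_apply, ContinuousLinearMap.id_apply, hx'.self_apply_inverse, add_sub_cancel_right,
        sub_add_cancel, hx'.inverse_apply_self]
  · simp [hcoe, hCe x (hsource hx) v]
  · have h1 := hgB (ψ x)
    have h2 : g (ψ x) = C (ψ.symm (ψ x)) (f₁ (ψ.symm (ψ x))) := (hball (hmem x hx)).1
    rw [ψ.left_inv (hsource hx)] at h2
    simp [hcoe, ← hψ2 x (hsource hx), ← h2, h1]

end NormalForm

/-! ### Equivalence to the index-1 Weierstrass form -/

/-- Differentiating `ψ ∘ ψ⁻¹ = id` and `ψ⁻¹ ∘ ψ = id` exhibits the derivative of `ψ⁻¹` as a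
two-sided inverse. -/
theorem OpenPartialHomeomorph.isInvertible_fderiv {V V' : Type} [NormedAddCommGroup V]
    [NormedSpace ℝ V] [NormedAddCommGroup V'] [NormedSpace ℝ V'] {ψ : OpenPartialHomeomorph V V'}
    (hψ : ContDiffOn ℝ ∞ ψ ψ.source) (hψ' : ContDiffOn ℝ ∞ ψ.symm ψ.target) {x : V}
    (hx : x ∈ ψ.source) : (fderiv ℝ ψ x).IsInvertible := by
  have h1 : HasFDerivAt ψ (fderiv ℝ ψ x) x :=
    ((hψ.contDiffAt (ψ.open_source.mem_nhds hx)).differentiableAt (by simp)).hasFDerivAt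
  have h2 : HasFDerivAt ψ.symm (fderiv ℝ ψ.symm (ψ x)) (ψ x) :=
    ((hψ'.contDiffAt (ψ.open_target.mem_nhds (ψ.map_source hx))).differentiableAt
      (by simp)).hasFDerivAt
  have h1' : HasFDerivAt ψ (fderiv ℝ ψ x) (ψ.symm (ψ x)) := by rwa [ψ.left_inv hx]
  refine ContinuousLinearMap.IsInvertible.of_inverse (g := fderiv ℝ ψ.symm (ψ x)) ?_ ?_
  · refine (h1'.comp _ h2).unique ((hasFDerivAt_id _).congr_of_eventuallyEq ?_)
    filter_upwards [ψ.open_target.mem_nhds (ψ.map_source hx)] with y hy using ψ.right_inv hy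
  · refine (h2.comp _ h1).unique ((hasFDerivAt_id _).congr_of_eventuallyEq ?_)
    filter_upwards [ψ.open_source.mem_nhds hx] with y hy using ψ.left_inv hy

section TangentSpace

variable {V : Type} [NormedAddCommGroup V] [NormedSpace ℝ V]

theorem tangentSpaceAt_mono {M N : Set V} (h : M ⊆ N) (x : V) :
    tangentSpaceAt M x ⊆ tangentSpaceAt N x := by
  rintro v ⟨γ, h1, h2, h3, h4⟩
  exact ⟨γ, h1, h2, h3, h4.mono fun t ht => h ht⟩

theorem tangentSpaceAt_inter_of_isOpen {M U : Set V} (hU : IsOpen U) {x : V} (hx : x ∈ U) :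
    tangentSpaceAt (M ∩ U) x = tangentSpaceAt M x := by
  refine (tangentSpaceAt_mono inter_subset_left x).antisymm ?_
  rintro v ⟨γ, h1, h2, h3, h4⟩
  exact ⟨γ, h1, h2, h3, h4.and (h1.continuousAt.eventually_mem (hU.mem_nhds (h2.symm ▸ hx)))⟩

theorem tangentSpaceAt_of_isOpen {U : Set V} (hU : IsOpen U) {x : V} (hx : x ∈ U) :
    tangentSpaceAt U x = univ := by
  refine eq_univ_of_forall fun v => ⟨fun t => x + t • v, by fun_prop, by simp, ?_, ?_⟩
  · simpa using ((hasDerivAt_id (0 : ℝ)).smul_const v).const_add x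
  · have : ContinuousAt (fun t : ℝ => x + t • v) 0 := by fun_prop
    exact this.eventually_mem (hU.mem_nhds (by simpa using hx))

end TangentSpace

namespace DAE

/-- `M₀` is open, so its tangent spaces are everything and the first step only asks that `F x` lie
in the range of `E x`. -/
theorem mem_reduction_one {V : Type} [NormedAddCommGroup V] [NormedSpace ℝ V] (Ξ : DAE V) {x : V} :
    x ∈ Ξ.reduction 1 ↔ x ∈ Ξ.X ∧ ∃ v, Ξ.E x v = Ξ.F x := by
  refine and_congr_right fun hx => ?_
  simp [reduction, tangentSpaceAt_of_isOpen Ξ.isOpen_X hx]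

section

variable {n r s : ℕ} {Ξ : DAE (Vec n)} {U : Set (Vec n)} {Q : Vec n → Vec n →L[ℝ] Vec r × Vec s}

theorem IsRowReduction.apply_eq (hQ : Ξ.IsRowReduction U Q) {x : Vec n} (hx : x ∈ U) (v : Vec n) :
    Q x (Ξ.E x v) = ((Q x (Ξ.E x v)).1, 0) :=
  Prod.ext rfl (hQ.snd_eq_zero x hx v)

theorem IsRowReduction.eq_zero_of_fst (hQ : Ξ.IsRowReduction U Q) {x : Vec n} (hx : x ∈ U)
    {v : Vec n} (h : (Q x (Ξ.E x v)).1 = 0) : Ξ.E x v = 0 := by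
  refine (hQ.invertible x hx).injective ?_
  rw [hQ.apply_eq hx, h, map_zero]
  rfl

/-- On the domain of a row reduction, the first reduction step yields the zero set of the algebraic
part. -/
theorem IsRowReduction.reduction_one_inter (hQ : Ξ.IsRowReduction U Q) (hU : U ⊆ Ξ.X) :
    Ξ.reduction 1 ∩ U = {x ∈ U | Ξ.algebraicPart Q x = 0} := by
  ext x
  rw [mem_inter_iff, mem_reduction_one]
  constructor
  · rintro ⟨⟨-, v, hv⟩, hx⟩
    refine ⟨hx, ?_⟩
    rw [algebraicPart, ← hv, hQ.snd_eq_zero x hx]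
  · rintro ⟨hx, h⟩
    obtain ⟨v, hv⟩ := hQ.surjective_fst x hx (Q x (Ξ.F x)).1
    refine ⟨⟨hU hx, v, (hQ.invertible x hx).injective (Prod.ext hv ?_)⟩, hx⟩
    rw [hQ.snd_eq_zero x hx]
    exact h.symm

/-- Index 1 and the clean intersection property make `v ↦ (E₁ v, D F₂ v)` injective. -/
theorem IsRowReduction.eq_zero_of_index_one (hQ : Ξ.IsRowReduction U Q) (hUo : IsOpen U)
    (hU : U ⊆ Ξ.X) {xp : Vec n} (hxp : xp ∈ U) (hend : Ξ.ReductionEndsAt xp 1)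
    (hT : tangentSpaceAt {y ∈ U | Ξ.algebraicPart Q y = 0} xp =
      {v | fderiv ℝ (Ξ.algebraicPart Q) xp v = 0}) {w : Vec n}
    (h1 : (Q xp (Ξ.E xp w)).1 = 0) (h2 : fderiv ℝ (Ξ.algebraicPart Q) xp w = 0) : w = 0 := by
  obtain ⟨hmem, W, -, hxW, -, huniq⟩ := hend
  have hT' : tangentSpaceAt (Ξ.reduction 1) xp =
      {v | fderiv ℝ (Ξ.algebraicPart Q) xp v = 0} := by
    rw [← hT, ← hQ.reduction_one_inter hU, tangentSpaceAt_inter_of_isOpen hUo hxp]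
  obtain ⟨v, ⟨hv1, hv2⟩, hv3⟩ := huniq xp ⟨hmem, hxW⟩
  -- Both `v` and `v + w` are tangent to `M₁` and solve the DAE at `xp`; uniqueness forces `w = 0`.
  have h3 := hv3 (v + w) ⟨?_, ?_⟩
  · simpa using h3
  · rw [hT', mem_ofPred_eq] at hv1 ⊢
    rw [map_add, hv1, h2, add_zero]
  · simp only [map_add, hv2, hQ.eq_zero_of_fst hxp h1, add_zero]

theorem IsRowReduction.finrank_eq (hQ : Ξ.IsRowReduction U Q) {x : Vec n} (hx : x ∈ U) :
    n = r + s := by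
  obtain ⟨A, -⟩ := hQ.invertible x hx
  simpa using A.toLinearEquiv.finrank_eq

theorem contDiffOn_algebraicPart (hQ : Ξ.IsRowReduction U Q) (hU : U ⊆ Ξ.X) :
    ContDiffOn ℝ ∞ (Ξ.algebraicPart Q) U :=
  contDiff_snd.comp_contDiffOn (hQ.smooth.clm_apply (Ξ.smooth_F.mono hU))

end

/-- The involutivity of a distribution `ker e` is invariant under affine changes of coordinates. -/
theorem KerInvolutiveOn.affine {V V' G : Type} [NormedAddCommGroup V] [NormedSpace ℝ V]
    [NormedAddCommGroup V'] [NormedSpace ℝ V'] [NormedAddCommGroup G] [NormedSpace ℝ G]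
    {Ξ : DAE V} {U : Set V} (hinv : Ξ.KerInvolutiveOn U) (P : V ≃L[ℝ] V') (a : V)
    {e : V' → V' →L[ℝ] G}
    (he : ∀ y, a + P.symm y ∈ U → ∀ v, e y v = 0 ↔ Ξ.E (a + P.symm y) (P.symm v) = 0)
    {W : Set V'} (hW : IsOpen W) (hWU : ∀ y ∈ W, a + P.symm y ∈ U) {f g : V' → V'}
    (hf : ContDiffOn ℝ ∞ f W) (hg : ContDiffOn ℝ ∞ g W) (hef : ∀ y ∈ W, e y (f y) = 0)
    (heg : ∀ y ∈ W, e y (g y) = 0) {y : V'} (hy : y ∈ W) :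
    e y (VectorField.lieBracket ℝ f g y) = 0 := by
  let S : V → V' := fun x => P (x - a)
  have hS : ContDiff ℝ ∞ S := P.contDiff.comp (contDiff_id.sub contDiff_const)
  have hSd : ∀ x, HasFDerivAt S (P : V →L[ℝ] V') x := fun x =>
    P.hasFDerivAt.comp x ((hasFDerivAt_id x).sub_const a)
  have hSy : ∀ y, S (a + P.symm y) = y := fun y => by simp [S]
  have hxS : ∀ x, a + P.symm (S x) = x := fun x => by simp [S]
  -- The change of coordinates has constant derivative, so pulled-back fields produce no
  -- second-order terms and the bracket is transported by `P.symm`.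
  have hd : ∀ f : V' → V', ContDiffOn ℝ ∞ f W → ∀ w,
      fderiv ℝ (fun x => P.symm (f (S x))) (a + P.symm y) (P.symm w) =
        P.symm (fderiv ℝ f y w) := by
    intro f hf w
    have h1 : HasFDerivAt f (fderiv ℝ f y) (S (a + P.symm y)) := by
      rw [hSy]
      exact ((hf.contDiffAt (hW.mem_nhds hy)).differentiableAt (by simp)).hasFDerivAt
    have h2 : HasFDerivAt (fun x => P.symm (f (S x))) _ (a + P.symm y) :=
      P.symm.hasFDerivAt.comp _ (h1.comp _ (hSd _))
    rw [h2.fderiv]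
    simp
  have hsm : ∀ f : V' → V', ContDiffOn ℝ ∞ f W →
      ContDiffOn ℝ ∞ (fun x => P.symm (f (S x))) (S ⁻¹' W) := fun f hf =>
    P.symm.contDiff.comp_contDiffOn (hf.comp hS.contDiffOn fun x hx => hx)
  have hSU : ∀ x ∈ S ⁻¹' W, x ∈ U := fun x hx => by
    have := hWU _ hx
    rwa [hxS] at this
  have hk : ∀ f : V' → V', (∀ y ∈ W, e y (f y) = 0) → ∀ x ∈ S ⁻¹' W,
      Ξ.E x (P.symm (f (S x))) = 0 := fun f hf x hx => by
    have := (he (S x) (hWU _ hx) _).1 (hf _ hx)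
    rwa [hxS] at this
  have h := hinv (S ⁻¹' W) (hW.preimage hS.continuous) hSU _ _ (hsm f hf) (hsm g hg) (hk f hef)
    (hk g heg) (a + P.symm y) (by rwa [mem_preimage, hSy])
  rw [he y (hWU y hy)]
  rw [VectorField.lieBracket] at h ⊢
  simp only [hSy, hd f hf, hd g hg] at h
  rwa [map_sub]

variable {n : ℕ}

/-- Existence of the index-1 nonlinear Weierstrass form. -/
theorem exists_isEquivINWFOn (Ξ : DAE (Vec n)) (xp : Vec n) (U : Set (Vec n))
    (hCR : Ξ.ConstantRankOn xp U) (hend : Ξ.ReductionEndsAt xp 1) (hinv : Ξ.KerInvolutiveOn U) :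
    ∃ (V : Set (Vec n)) (r s : ℕ) (Q : Vec n → Vec n →L[ℝ] Vec r × Vec s)
        (ψ : OpenPartialHomeomorph (Vec n) (Vec r × Vec s)),
      IsOpen V ∧ xp ∈ V ∧ V ⊆ U ∧ ContDiffOn ℝ ∞ Q V ∧ Ξ.IsEquivINWFOn V Q ψ := by
  obtain ⟨hUo, hxp, hUX, r, s, Q, -, hQ, h0, -, hT, -⟩ := hCR
  have hF₂ := contDiffOn_algebraicPart hQ hUX
  -- In the linear coordinates `(E₁, DF₂)` taken at `xp`, the reduced `e` and the derivative of the
  -- constraint become the two projections at the origin.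
  let P₀ : Vec n →L[ℝ] Vec r × Vec s :=
    ((ContinuousLinearMap.fst ℝ _ _).comp ((Q xp).comp (Ξ.E xp))).prod
      (fderiv ℝ (Ξ.algebraicPart Q) xp)
  have hP₀ : Function.Injective P₀ := by
    refine (injective_iff_map_eq_zero P₀).2 fun w hw => ?_
    exact hQ.eq_zero_of_index_one hUo hUX hxp hend (hT xp hxp h0) (congrArg Prod.fst hw)
      (congrArg Prod.snd hw)
  let P : Vec n ≃L[ℝ] Vec r × Vec s := (LinearEquiv.ofInjectiveOfFinrankEq P₀.toLinearMap hP₀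
    (by simpa using hQ.finrank_eq hxp)).toContinuousLinearEquiv
  have hP : ∀ v, P v = ((Q xp (Ξ.E xp v)).1, fderiv ℝ (Ξ.algebraicPart Q) xp v) := fun v => rfl
  let T : Vec r × Vec s → Vec n := fun y => xp + P.symm y
  have hT : ContDiff ℝ ∞ T := contDiff_const.add P.symm.contDiff
  have hT0 : T 0 = xp := by simp [T]
  have hmaps : MapsTo T (T ⁻¹' U) U := fun y hy => hy
  let e : Vec r × Vec s → Vec r × Vec s →L[ℝ] Vec r := fun y =>
    (ContinuousLinearMap.fst ℝ _ _).comp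
      ((Q (T y)).comp ((Ξ.E (T y)).comp (P.symm : Vec r × Vec s →L[ℝ] Vec n)))
  have he_apply : ∀ y v, e y v = (Q (T y) (Ξ.E (T y) (P.symm v))).1 := fun y v => rfl
  have he : ContDiffOn ℝ ∞ e (T ⁻¹' U) :=
    contDiffOn_const.clm_comp ((hQ.smooth.comp hT.contDiffOn hmaps).clm_comp
      (((Ξ.smooth_E.mono hUX).comp hT.contDiffOn hmaps).clm_comp contDiffOn_const))
  have hf₁ : ContDiffOn ℝ ∞ (fun y => (Q (T y) (Ξ.F (T y))).1) (T ⁻¹' U) :=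
    contDiff_fst.comp_contDiffOn ((hQ.smooth.comp hT.contDiffOn hmaps).clm_apply
      ((Ξ.smooth_F.mono hUX).comp hT.contDiffOn hmaps))
  have hf₂ : ContDiffOn ℝ ∞ (fun y => Ξ.algebraicPart Q (T y)) (T ⁻¹' U) :=
    hF₂.comp hT.contDiffOn hmaps
  have he0 : e 0 = ContinuousLinearMap.fst ℝ _ _ := by
    refine ContinuousLinearMap.ext fun v => ?_
    have := congrArg Prod.fst (hP (P.symm v))
    rw [P.apply_symm_apply] at this
    rw [he_apply, hT0, ← this]
    rfl
  have hdf0 : fderiv ℝ (fun y => Ξ.algebraicPart Q (T y)) 0 = ContinuousLinearMap.snd ℝ _ _ := by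
    have h1 : HasFDerivAt (Ξ.algebraicPart Q) (fderiv ℝ (Ξ.algebraicPart Q) xp) (T 0) := by
      rw [hT0]
      exact ((hF₂.contDiffAt (hUo.mem_nhds hxp)).differentiableAt (by simp)).hasFDerivAt
    have h2 : HasFDerivAt (fun y => Ξ.algebraicPart Q (T y)) _ 0 :=
      h1.comp 0 (P.symm.hasFDerivAt.const_add xp)
    rw [h2.fderiv]
    refine ContinuousLinearMap.ext fun v => ?_
    have := congrArg Prod.snd (hP (P.symm v))
    rw [P.apply_symm_apply] at this
    exact this.symm
  obtain ⟨ψ₀, X₁, X₂, Q₀, Fstar, h0ψ, hψO, hX₁, hX₂, htarget, hψs, hψsymm, hQ₀, hFstar, hQ₀inv,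
    hQ₀e, hQ₀f⟩ := exists_normal_form (hUo.preimage hT.continuous)
      (show (0 : Vec r × Vec s) ∈ T ⁻¹' U by rwa [mem_preimage, hT0]) he hf₁ hf₂ he0
      (by simpa [hT0] using h0) hdf0 (fun W hW hWO f g hf hg hef heg y hy =>
        hinv.affine P xp (e := e) (fun y hy v => ⟨fun h => hQ.eq_zero_of_fst hy h, fun h => by
          rw [he_apply, show Ξ.E (T y) (P.symm v) = 0 from h, map_zero, Prod.fst_zero]⟩)
          hW hWO hf hg hef heg hy)
  let S : Vec n ≃ₜ Vec r × Vec s := (Homeomorph.subRight xp).trans P.toHomeomorph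
  have hS : ∀ x, S x = P (x - xp) := fun x => rfl
  have hTS : ∀ x, T (S x) = x := fun x => by simp [hS, T]
  have hSsm : ContDiff ℝ ∞ S := P.contDiff.comp (contDiff_id.sub contDiff_const)
  have hSd : ∀ x, HasFDerivAt S (P : Vec n →L[ℝ] Vec r × Vec s) x := fun x =>
    P.hasFDerivAt.comp x ((hasFDerivAt_id x).sub_const xp)
  have hSsymm : ∀ y, S.symm y = T y := fun y => by
    rw [Homeomorph.symm_apply_eq, hS]
    simp [T]
  let ψ : OpenPartialHomeomorph (Vec n) (Vec r × Vec s) := S.transOpenPartialHomeomorph ψ₀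
  have hψ : ∀ x, ψ x = ψ₀ (S x) := fun x => rfl
  have hsource : ∀ x ∈ ψ.source, S x ∈ ψ₀.source := fun x hx => hx
  have hsub : ψ.source ⊆ U := fun x hx => by
    have := hψO (hsource x hx)
    rwa [mem_preimage, hTS] at this
  have hψsmooth : ContDiffOn ℝ ∞ ψ ψ.source := hψs.comp hSsm.contDiffOn hsource
  have hψsymm_smooth : ContDiffOn ℝ ∞ ψ.symm ψ.target :=
    (hT.comp_contDiffOn hψsymm).congr fun y _ => hSsymm _
  let Ξ' : DAE (Vec r × Vec s) :=
    { X := X₁ ×ˢ X₂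
      E := fun _ => (ContinuousLinearMap.id ℝ (Vec r)).prodMap (0 : Vec s →L[ℝ] Vec s)
      F := fun ξ => (Fstar ξ.1, ξ.2)
      isOpen_X := hX₁.prod hX₂
      smooth_E := contDiffOn_const
      smooth_F := ((hFstar.comp contDiff_fst).prodMk contDiff_snd).contDiffOn }
  refine ⟨ψ.source, r, s, fun x => (Q₀ (S x)).comp (Q x), ψ, ψ.open_source, ?_, hsub,
    (hQ₀.comp hSsm.contDiffOn hsource).clm_comp (hQ.smooth.mono hsub), rfl, Ξ',
    ⟨X₁, X₂, Fstar, hX₁, hX₂, rfl, fun ξ _ => ⟨rfl, rfl⟩⟩, hsub.trans hUX, htarget, hψsmooth,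
    hψsymm_smooth, fun x hx => (hQ₀inv _ (hsource x hx)).comp (hQ.invertible x (hsub hx)),
    fun x hx => ?_, fun x hx => ?_⟩
  · change S xp ∈ ψ₀.source
    rwa [hS, sub_self, map_zero]
  · have hD := OpenPartialHomeomorph.isInvertible_fderiv hψsmooth hψsymm_smooth hx
    refine ContinuousLinearMap.ext fun v => ?_
    obtain ⟨w, rfl⟩ := hD.surjective v
    simp only [ContinuousLinearMap.comp_apply, hD.inverse_apply_self]
    have h1 : HasFDerivAt ψ ((fderiv ℝ ψ₀ (S x)).comp (P : Vec n →L[ℝ] Vec r × Vec s)) x :=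
      ((hψs.contDiffAt (ψ₀.open_source.mem_nhds (hsource x hx))).differentiableAt
        (by simp)).hasFDerivAt.comp x (hSd x)
    have h2 := hQ₀e (S x) (hsource x hx) (P w)
    rw [he_apply, hTS, P.symm_apply_apply, ← hQ.apply_eq (hsub hx)] at h2
    rw [h2, h1.fderiv]
    rfl
  · have h1 := hQ₀f (S x) (hsource x hx)
    simp only [hTS] at h1
    exact h1.symm

end DAE

/-! ### Uniqueness of solutions with a prescribed limit at the initial time -/

section Uniqueness

variable {E : Type} [NormedAddCommGroup E] [NormedSpace ℝ E]

/-- A solution of an ODE on `(0, t₁]` with a limit at `0` extends to a solution on `[0, t₁]`. -/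
theorem hasDerivWithinAt_update_of_tendsto {f : E → E} {X : Set E} (hX : IsOpen X)
    (hf : ContinuousOn f X) {t₁ : ℝ} (ht₁ : 0 < t₁) {y : ℝ → E} {y₀ : E} (hy₀ : y₀ ∈ X)
    (hy : ∀ t ∈ Ioc 0 t₁, HasDerivAt y (f (y t)) t) (hlim : Tendsto y (𝓝[>] 0) (𝓝 y₀)) :
    ContinuousOn (Function.update y 0 y₀) (Icc 0 t₁) ∧
      ∀ t ∈ Ico 0 t₁, HasDerivWithinAt (Function.update y 0 y₀)
        (f (Function.update y 0 y₀ t)) (Ici t) t := by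
  have heq : ∀ t ∈ Ioi (0 : ℝ), Function.update y 0 y₀ =ᶠ[𝓝 t] y := fun t ht => by
    filter_upwards [isOpen_Ioi.mem_nhds ht] with s hs
    exact Function.update_of_ne (ne_of_gt hs) _ _
  have hd : ∀ t ∈ Ioc 0 t₁, HasDerivAt (Function.update y 0 y₀)
      (f (Function.update y 0 y₀ t)) t := fun t ht => by
    rw [Function.update_of_ne ht.1.ne']
    exact (hy t ht).congr_of_eventuallyEq (heq t ht.1)
  have hc0 : ∀ s ⊆ Ici (0 : ℝ), ContinuousWithinAt (Function.update y 0 y₀) s 0 := fun s hs => by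
    rw [continuousWithinAt_update_same]
    refine hlim.mono_left (nhdsWithin_mono _ fun t ht => ?_)
    exact lt_of_le_of_ne (hs ht.1) (Ne.symm ht.2)
  constructor
  · intro t ht
    rcases ht.1.eq_or_lt with rfl | h
    · exact hc0 _ Icc_subset_Ici_self
    · exact (hd t ⟨h, ht.2⟩).continuousAt.continuousWithinAt
  · intro t ht
    rcases ht.1.eq_or_lt with rfl | h
    -- At the endpoint the one-sided derivative is the limit of `f (y t)` as `t → 0⁺`, which is `f
    -- y₀` by continuity.
    · refine hasDerivWithinAt_Ici_of_tendsto_deriv (s := Ioo 0 t₁)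
        (fun t ht => (hd t (Ioo_subset_Ioc_self ht)).differentiableAt.differentiableWithinAt)
        (hc0 _ fun t ht => ht.1.le) (Ioo_mem_nhdsGT ht₁) ?_
      rw [Function.update_self]
      refine (((hf.continuousAt (hX.mem_nhds hy₀)).tendsto).comp hlim).congr' ?_
      filter_upwards [Ioo_mem_nhdsGT ht₁] with t ht
      have := (hd t (Ioo_subset_Ioc_self ht)).deriv
      rw [Function.update_of_ne ht.1.ne'] at this
      exact this.symm
    · exact (hd t ⟨h, ht.2.le⟩).hasDerivWithinAt

/-- Two solutions of an autonomous ODE on `(0, t₁]` with the same limit at `0` coincide. -/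
theorem eq_of_hasDerivAt_of_tendsto {f : E → E} {X : Set E} (hX : IsOpen X)
    (hf : ContDiffOn ℝ 1 f X) {t₁ : ℝ} (ht₁ : 0 < t₁) {y z : ℝ → E} {y₀ : E} (hy₀ : y₀ ∈ X)
    (hyX : ∀ t ∈ Ioc 0 t₁, y t ∈ X) (hzX : ∀ t ∈ Ioc 0 t₁, z t ∈ X)
    (hy : ∀ t ∈ Ioc 0 t₁, HasDerivAt y (f (y t)) t) (hz : ∀ t ∈ Ioc 0 t₁, HasDerivAt z (f (z t)) t)
    (hylim : Tendsto y (𝓝[>] 0) (𝓝 y₀)) (hzlim : Tendsto z (𝓝[>] 0) (𝓝 y₀)) : y t₁ = z t₁ := by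
  obtain ⟨hyc, hyd⟩ := hasDerivWithinAt_update_of_tendsto hX hf.continuousOn ht₁ hy₀ hy hylim
  obtain ⟨hzc, hzd⟩ := hasDerivWithinAt_update_of_tendsto hX hf.continuousOn ht₁ hy₀ hz hzlim
  set u := Function.update y 0 y₀
  set v := Function.update z 0 y₀
  have hmaps : ∀ w : ℝ → E, (∀ t ∈ Ioc 0 t₁, w t ∈ X) →
      MapsTo (Function.update w 0 y₀) (Icc 0 t₁) X := by
    intro w hw t ht
    rcases ht.1.eq_or_lt with rfl | h
    · rwa [Function.update_self]
    · rw [Function.update_of_ne h.ne']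
      exact hw t ⟨h, ht.2⟩
  -- Local Lipschitz bounds become one uniform bound on the compact union of both trajectories; `X`
  -- need not be convex.
  have hK : IsCompact (u '' Icc 0 t₁ ∪ v '' Icc 0 t₁) :=
    (isCompact_Icc.image_of_continuousOn hyc).union (isCompact_Icc.image_of_continuousOn hzc)
  have hKX : u '' Icc 0 t₁ ∪ v '' Icc 0 t₁ ⊆ X :=
    union_subset (hmaps y hyX).image_subset (hmaps z hzX).image_subset
  obtain ⟨L, hL⟩ := LocallyLipschitzOn.exists_lipschitzOnWith_of_compact hK (f := f) (by
    intro x hx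
    obtain ⟨L, t, ht, hLt⟩ :=
      (hf.contDiffAt (hX.mem_nhds (hKX hx))).exists_lipschitzOnWith
    exact ⟨L, t, mem_nhdsWithin_of_mem_nhds ht, hLt⟩)
  have h := ODE_solution_unique_of_mem_Icc_right (v := fun _ => f)
    (s := fun _ => u '' Icc 0 t₁ ∪ v '' Icc 0 t₁) (fun _ _ => hL) hyc hyd
    (fun t ht => Or.inl (mem_image_of_mem u (Ico_subset_Icc_self ht))) hzc hzd
    (fun t ht => Or.inr (mem_image_of_mem v (Ico_subset_Icc_self ht)))
    (by simp only [u, v, Function.update_self]) (right_mem_Icc.2 ht₁.le)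
  simpa only [u, v, Function.update_of_ne ht₁.ne'] using h

/-- A solution of `ε ẏ = -y` on `(0, t₁]` with the limit `y₀` at `0` is `e^{-t/ε} y₀`. -/
theorem eq_exp_smul_of_hasDerivAt {ε t₁ : ℝ} (ht₁ : 0 < t₁) {y : ℝ → E} {y₀ : E}
    (hy : ∀ t ∈ Ioc 0 t₁, HasDerivAt y (-(ε⁻¹ • y t)) t) (hlim : Tendsto y (𝓝[>] 0) (𝓝 y₀)) :
    y t₁ = Real.exp (-(ε⁻¹ * t₁)) • y₀ := by
  have hexp : ∀ t, HasDerivAt (fun t => Real.exp (-(ε⁻¹ * t)) • y₀)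
      (-(ε⁻¹ • Real.exp (-(ε⁻¹ * t)) • y₀)) t := fun t => by
    have h1 : HasDerivAt (fun t => -(ε⁻¹ * t)) (-ε⁻¹) t := by
      have := ((hasDerivAt_id t).const_mul ε⁻¹).fun_neg
      rwa [mul_one] at this
    have h2 := (h1.exp).smul_const y₀
    convert h2 using 1
    rw [mul_neg, neg_smul, mul_smul, smul_comm]
  refine eq_of_hasDerivAt_of_tendsto (f := fun y => -(ε⁻¹ • y)) isOpen_univ
    (by fun_prop) ht₁ (mem_univ y₀) (fun _ _ => mem_univ _) (fun _ _ => mem_univ _) hy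
    (fun t _ => hexp t) hlim ?_
  have h := (hexp 0).continuousAt.tendsto
  simp only [mul_zero, neg_zero, Real.exp_zero, one_smul] at h
  exact h.mono_left nhdsWithin_le_nhds

end Uniqueness

/-! ### Convergence of the perturbed systems in a Weierstrass chart -/

namespace DAE

variable {n r s : ℕ} {Ξ : DAE (Vec n)} {V : Set (Vec n)} {Q : Vec n → Vec n →L[ℝ] Vec r × Vec s}
  {ψ : OpenPartialHomeomorph (Vec n) (Vec r × Vec s)}

/-- The data of an equivalence to an index-1 Weierstrass form, spelled out. -/
structure IsWeierstrassChart (Ξ : DAE (Vec n)) (V : Set (Vec n))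
    (Q : Vec n → Vec n →L[ℝ] Vec r × Vec s)
    (ψ : OpenPartialHomeomorph (Vec n) (Vec r × Vec s)) (X₁ : Set (Vec r)) (X₂ : Set (Vec s))
    (Fstar : Vec r → Vec r) : Prop where
  source_eq : ψ.source = V
  target_eq : ψ.target = X₁ ×ˢ X₂
  isOpen_fst : IsOpen X₁
  subset : V ⊆ Ξ.X
  smooth : ContDiffOn ℝ ∞ ψ V
  smooth_symm : ContDiffOn ℝ ∞ ψ.symm ψ.target
  smooth_field : ContDiffOn ℝ ∞ (fun ξ : Vec r × Vec s => Fstar ξ.1) (X₁ ×ˢ X₂)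
  invertible : ∀ x ∈ V, (Q x).IsInvertible
  map_E : ∀ x ∈ V, ∀ v, Q x (Ξ.E x v) = ((fderiv ℝ ψ x v).1, 0)
  map_F : ∀ x ∈ V, Q x (Ξ.F x) = (Fstar (ψ x).1, (ψ x).2)

/-- `IsINWF` does not ask `Fstar` to be smooth: its smoothness is read off from `Ξ'.F`, hence only
as a function on the product. -/
theorem IsEquivINWFOn.exists_isWeierstrassChart (h : Ξ.IsEquivINWFOn V Q ψ) :
    ∃ X₁ X₂ Fstar, Ξ.IsWeierstrassChart V Q ψ X₁ X₂ Fstar := by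
  obtain ⟨rfl, Ξ', ⟨X₁, X₂, Fstar, hX₁, hX₂, hX, hΞ'⟩, hequiv⟩ := h
  have hmem : ∀ x ∈ ψ.source, ψ x ∈ Ξ'.X := fun x hx => hequiv.target_eq ▸ ψ.map_source hx
  refine ⟨X₁, X₂, Fstar, rfl, hequiv.target_eq.trans hX, hX₁, hequiv.source_subset, hequiv.smooth,
    hequiv.smooth_symm, ?_, hequiv.invertible, fun x hx v => ?_, fun x hx => ?_⟩
  · rw [← hX]
    exact (contDiff_fst.comp_contDiffOn Ξ'.smooth_F).congr fun ξ hξ => by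
      rw [Function.comp_apply, (hΞ' ξ hξ).2]
  · have h1 := congrArg (fun A => A (fderiv ℝ ψ x v)) (hequiv.map_E x hx)
    simp only [(hΞ' _ (hmem x hx)).1, ContinuousLinearMap.comp_apply,
      (OpenPartialHomeomorph.isInvertible_fderiv hequiv.smooth
        hequiv.smooth_symm hx).inverse_apply_self] at h1
    exact h1.symm
  · rw [← hequiv.map_F x hx, (hΞ' _ (hmem x hx)).2]

namespace IsWeierstrassChart

variable {X₁ : Set (Vec r)} {X₂ : Set (Vec s)} {Fstar : Vec r → Vec r}
  (h : Ξ.IsWeierstrassChart V Q ψ X₁ X₂ Fstar)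

include h

theorem isOpen : IsOpen V := h.source_eq ▸ ψ.open_source

theorem isInvertible_fderiv {x : Vec n} (hx : x ∈ V) : (fderiv ℝ ψ x).IsInvertible :=
  OpenPartialHomeomorph.isInvertible_fderiv (h.source_eq.symm ▸ h.smooth) h.smooth_symm
    (h.source_eq.symm ▸ hx)

theorem hasFDerivAt {x : Vec n} (hx : x ∈ V) : HasFDerivAt ψ (fderiv ℝ ψ x) x :=
  ((h.smooth.contDiffAt (h.isOpen.mem_nhds hx)).differentiableAt (by simp)).hasFDerivAt

theorem map_mem {x : Vec n} (hx : x ∈ V) : (ψ x).1 ∈ X₁ ∧ (ψ x).2 ∈ X₂ := by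
  have := ψ.map_source (h.source_eq.symm ▸ hx)
  rwa [h.target_eq] at this

theorem symm_mem {ξ : Vec r × Vec s} (h1 : ξ.1 ∈ X₁) (h2 : ξ.2 ∈ X₂) :
    ξ ∈ ψ.target ∧ ψ.symm ξ ∈ V := by
  have : ξ ∈ ψ.target := h.target_eq.symm ▸ ⟨h1, h2⟩
  exact ⟨this, h.source_eq ▸ ψ.map_target this⟩

/-- Restriction to the slice `ξ₂ = 0`; some point of `X₂` is needed, since over an empty product
nothing is known about `Fstar`. -/
theorem contDiffOn_field (h0 : (0 : Vec s) ∈ X₂) : ContDiffOn ℝ ∞ Fstar X₁ :=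
  h.smooth_field.comp (g := fun ξ : Vec r × Vec s => Fstar ξ.1)
    (f := fun y : Vec r => (y, (0 : Vec s)))
    (contDiff_id.prodMk contDiff_const).contDiffOn fun _ hy => ⟨hy, h0⟩

theorem snd_eq_zero {x v : Vec n} (hx : x ∈ V) (hv : Ξ.E x v = Ξ.F x) :
    (fderiv ℝ ψ x v).1 = Fstar (ψ x).1 ∧ (ψ x).2 = 0 := by
  have h1 := h.map_E x hx v
  rw [hv, h.map_F x hx] at h1
  exact ⟨(congrArg Prod.fst h1).symm, congrArg Prod.snd h1⟩

/-- The perturbation fills the zero block of the normal form with `-ε I`, giving `Q E_ε = diag(I,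
-ε) Dψ`. -/
theorem apply_perturbedE {ε : ℝ} {x : Vec n} (hx : x ∈ V) (v : Vec n) :
    Q x (Ξ.perturbedE Q ψ ε x v) = ((fderiv ℝ ψ x v).1, -(ε • (fderiv ℝ ψ x v).2)) := by
  simp [perturbedE, (h.invertible x hx).self_apply_inverse, h.map_E x hx, Prod.ext_iff]

theorem isInvertible_perturbedE {ε : ℝ} (hε : ε ≠ 0) {x : Vec n} (hx : x ∈ V) :
    (Ξ.perturbedE Q ψ ε x).IsInvertible := by
  let D : ∀ a : ℝ, Vec r × Vec s →L[ℝ] Vec r × Vec s := fun a =>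
    (ContinuousLinearMap.id ℝ (Vec r)).prodMap (a • ContinuousLinearMap.id ℝ (Vec s))
  have hD : (D (-ε)).IsInvertible := by
    refine ContinuousLinearMap.IsInvertible.of_inverse (g := D (-ε)⁻¹) ?_ ?_ <;>
      refine ContinuousLinearMap.ext fun v => Prod.ext rfl ?_ <;>
      simp [D, smul_smul, hε]
  have heq : Ξ.perturbedE Q ψ ε x = (Q x).inverse.comp ((D (-ε)).comp (fderiv ℝ ψ x)) := by
    refine ContinuousLinearMap.ext fun v => (h.invertible x hx).injective ?_
    rw [h.apply_perturbedE hx]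
    simp [D, (h.invertible x hx).self_apply_inverse, Prod.ext_iff]
  rw [heq]
  exact (h.invertible x hx).inverse.comp (hD.comp (h.isInvertible_fderiv hx))

/-- In the coordinates `ψ` the perturbed system is `ξ̇₁ = F*(ξ₁)`, `ε ξ̇₂ = -ξ₂`. -/
theorem hasDerivAt_perturbed {ε : ℝ} (hε : ε ≠ 0) {x : ℝ → Vec n} {t : ℝ} (hx : x t ∈ V)
    (hd : HasDerivAt x ((Ξ.perturbedE Q ψ ε (x t)).inverse (Ξ.F (x t))) t) :
    HasDerivAt (fun t => (ψ (x t)).1) (Fstar (ψ (x t)).1) t ∧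
      HasDerivAt (fun t => (ψ (x t)).2) (-(ε⁻¹ • (ψ (x t)).2)) t := by
  set v := (Ξ.perturbedE Q ψ ε (x t)).inverse (Ξ.F (x t))
  have h1 : HasDerivAt (fun t => ψ (x t)) (fderiv ℝ ψ (x t) v) t :=
    (h.hasFDerivAt hx).comp_hasDerivAt t hd
  have h2 := h.apply_perturbedE (ε := ε) hx v
  rw [(h.isInvertible_perturbedE hε hx).self_apply_inverse, h.map_F _ hx] at h2
  have h3 : Fstar (ψ (x t)).1 = (fderiv ℝ ψ (x t) v).1 := congrArg Prod.fst h2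
  have h4 : (ψ (x t)).2 = -(ε • (fderiv ℝ ψ (x t) v).2) := congrArg Prod.snd h2
  constructor
  · rw [h3]
    exact hasFDerivAt_fst.comp_hasDerivAt t h1
  · rw [h4, smul_neg, neg_neg, smul_smul, inv_mul_cancel₀ hε, one_smul]
    exact hasFDerivAt_snd.comp_hasDerivAt t h1

/-- In the coordinates `ψ` the DAE is `ξ̇₁ = F*(ξ₁)`, `0 = ξ₂`. -/
theorem hasDerivAt_solution {x : ℝ → Vec n} {t : ℝ} (hx : x t ∈ V) {v : Vec n}
    (hd : HasDerivAt x v t) (hv : Ξ.E (x t) v = Ξ.F (x t)) :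
    HasDerivAt (fun t => (ψ (x t)).1) (Fstar (ψ (x t)).1) t ∧ (ψ (x t)).2 = 0 := by
  obtain ⟨h1, h2⟩ := h.snd_eq_zero hx hv
  refine ⟨?_, h2⟩
  rw [← h1]
  exact hasFDerivAt_fst.comp_hasDerivAt t ((h.hasFDerivAt hx).comp_hasDerivAt t hd)

/-- The image of the chart is a product, so replacing the second coordinate by `0 ∈ X₂` does not
leave it. -/
theorem consistencyProjector_mem (h0 : (0 : Vec s) ∈ X₂) {x : Vec n} (hx : x ∈ V) :
    consistencyProjector ψ x ∈ V ∧ ψ (consistencyProjector ψ x) = ((ψ x).1, 0) := by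
  have := h.symm_mem (ξ := ((ψ x).1, 0)) (h.map_mem hx).1 h0
  exact ⟨this.2, ψ.right_inv this.1⟩

/-- A local integral curve `α` of `Fstar` from Picard–Lindelöf lifts to the solution `ψ⁻¹(α, 0)` of
the DAE. -/
theorem isConsistent_consistencyProjector (h0 : (0 : Vec s) ∈ X₂) {x : Vec n} (hx : x ∈ V) :
    Ξ.IsConsistent (consistencyProjector ψ x) := by
  have hx₁ := (h.map_mem hx).1
  have hF : ContDiffAt ℝ 1 Fstar (ψ x).1 :=
    ((h.contDiffOn_field h0).contDiffAt (h.isOpen_fst.mem_nhds hx₁)).of_le (by simp)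
  obtain ⟨α, hα0, ε, hε, hα⟩ :=
    hF.exists_forall_mem_closedBall_exists_eq_forall_mem_Ioo_hasDerivAt₀ 0
  have hcont : ContinuousAt α 0 := (hα 0 ⟨by linarith, by linarith⟩).continuousAt
  -- Picard–Lindelöf does not confine `α` to `X₁`; continuity at `0` does so after the time interval
  -- is shortened.
  obtain ⟨δ, hδ, hδX⟩ := Metric.mem_nhds_iff.1
    (hcont.preimage_mem_nhds (h.isOpen_fst.mem_nhds (hα0.symm ▸ hx₁)))
  refine ⟨-min ε δ, min ε δ, 0, fun t => ψ.symm (α t, 0), ⟨by simp [hε, hδ], by simp [hε, hδ]⟩,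
    fun t ht => ?_, by simp only [hα0, consistencyProjector]⟩
  have htX : α t ∈ X₁ := hδX (by
    rw [Metric.mem_ball, Real.dist_eq, sub_zero, abs_lt]
    exact ⟨by linarith [ht.1, min_le_right ε δ], by linarith [ht.2, min_le_right ε δ]⟩)
  have hαt := hα t ⟨by linarith [ht.1, min_le_left ε δ], by linarith [ht.2, min_le_left ε δ]⟩
  obtain ⟨hξ, hξV⟩ := h.symm_mem (ξ := (α t, 0)) htX h0
  have h1 : HasFDerivAt ψ.symm (fderiv ℝ ψ.symm (α t, 0)) (α t, 0) :=
    ((h.smooth_symm.contDiffAt (ψ.open_target.mem_nhds hξ)).differentiableAt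
      (by simp)).hasFDerivAt
  have h2 : HasDerivAt (fun t => ψ.symm (α t, 0)) (fderiv ℝ ψ.symm (α t, 0) (Fstar (α t), 0)) t :=
    h1.comp_hasDerivAt t (hαt.prodMk (hasDerivAt_const t 0))
  refine ⟨h.subset hξV, _, h2, (h.invertible _ hξV).injective ?_⟩
  have h3 : HasFDerivAt ψ (fderiv ℝ ψ (ψ.symm (α t, 0))) (ψ.symm (α t, 0)) := h.hasFDerivAt hξV
  have h4 : fderiv ℝ ψ (ψ.symm (α t, 0)) (fderiv ℝ ψ.symm (α t, 0) (Fstar (α t), 0)) =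
      (Fstar (α t), 0) := by
    have h5 := (h3.comp _ h1).unique ((hasFDerivAt_id (α t, (0 : Vec s))).congr_of_eventuallyEq
      (by filter_upwards [ψ.open_target.mem_nhds hξ] with y hy using ψ.right_inv hy))
    exact congrArg (fun A => A (Fstar (α t), 0)) h5
  rw [h.map_E _ hξV, h.map_F _ hξV, h4, ψ.right_inv hξ]

/-- The solution of the perturbed system at a fixed time, in terms of the solution of the DAE that
starts from the consistency projection of the initial value. -/
theorem perturbed_eq (h0 : (0 : Vec s) ∈ X₂) {ε t₁ : ℝ} (hε : ε ≠ 0) (ht₁ : 0 < t₁)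
    {x₀ : Vec n} (hx₀ : x₀ ∈ V) {y x : ℝ → Vec n}
    (hy : Ξ.IsPerturbedSolutionOn Q ψ ε V (Ioc 0 t₁) y) (hylim : Tendsto y (𝓝[>] 0) (𝓝 x₀))
    (hx : Ξ.IsSolutionOn (Ioc 0 t₁) x) (hxV : ∀ t ∈ Ioc 0 t₁, x t ∈ V)
    (hxlim : Tendsto x (𝓝[>] 0) (𝓝 (consistencyProjector ψ x₀))) :
    ψ (y t₁) = ((ψ (x t₁)).1, Real.exp (-(ε⁻¹ * t₁)) • (ψ x₀).2) := by
  obtain ⟨hpV, hp⟩ := h.consistencyProjector_mem h0 hx₀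
  have hyl : Tendsto (fun t => ψ (y t)) (𝓝[>] 0) (𝓝 (ψ x₀)) :=
    (h.hasFDerivAt hx₀).continuousAt.tendsto.comp hylim
  have hxl : Tendsto (fun t => ψ (x t)) (𝓝[>] 0) (𝓝 ((ψ x₀).1, 0)) := by
    rw [← hp]
    exact (h.hasFDerivAt hpV).continuousAt.tendsto.comp hxlim
  refine Prod.ext ?_ ?_
  -- The slow equation is free of `ε` and `ξ₂`, and the projection keeps `ξ₁`: both slow components
  -- solve one ODE with the same initial limit.
  · refine eq_of_hasDerivAt_of_tendsto (y := fun t => (ψ (y t)).1) (z := fun t => (ψ (x t)).1)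
      h.isOpen_fst ((h.contDiffOn_field h0).of_le (by simp)) ht₁ (h.map_mem hx₀).1
      (fun t ht => (h.map_mem (hy t ht).1).1) (fun t ht => (h.map_mem (hxV t ht)).1)
      (fun t ht => (h.hasDerivAt_perturbed hε (hy t ht).1 (hy t ht).2).1) (fun t ht => ?_)
      ((continuous_fst.tendsto (ψ x₀)).comp hyl)
      ((continuous_fst.tendsto ((ψ x₀).1, (0 : Vec s))).comp hxl)
    obtain ⟨-, v, hd, hv⟩ := hx t ht
    exact (h.hasDerivAt_solution (hxV t ht) hd hv).1
  · exact eq_exp_smul_of_hasDerivAt (y := fun t => (ψ (y t)).2) ht₁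
      (fun t ht => (h.hasDerivAt_perturbed hε (hy t ht).1 (hy t ht).2).2)
      ((continuous_snd.tendsto _).comp hyl)

/-- Solutions of the perturbed systems converge to the solution of the DAE that starts from the
consistency projection of the initial value. -/
theorem tendsto_perturbed (h0 : (0 : Vec s) ∈ X₂) {t₁ : ℝ} (ht₁ : 0 < t₁)
    {x₀ : Vec n} (hx₀ : x₀ ∈ V) {xbar : ℝ → ℝ → Vec n} {x : ℝ → Vec n}
    (hbar : ∀ᶠ ε in 𝓝[>] (0 : ℝ), Ξ.IsPerturbedSolutionOn Q ψ ε V (Ioc 0 t₁) (xbar ε) ∧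
      Tendsto (xbar ε) (𝓝[>] 0) (𝓝 x₀))
    (hx : Ξ.IsSolutionOn (Ioc 0 t₁) x) (hxV : ∀ t ∈ Ioc 0 t₁, x t ∈ V)
    (hxlim : Tendsto x (𝓝[>] 0) (𝓝 (consistencyProjector ψ x₀))) :
    Tendsto (fun ε => xbar ε t₁) (𝓝[>] 0) (𝓝 (x t₁)) := by
  have ht : t₁ ∈ Ioc 0 t₁ := right_mem_Ioc.2 ht₁
  have hxt := hxV t₁ ht
  have hψx : ψ (x t₁) = ((ψ (x t₁)).1, 0) := by
    obtain ⟨-, v, hd, hv⟩ := hx t₁ ht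
    exact Prod.ext rfl (h.hasDerivAt_solution hxt hd hv).2
  have hexp : Tendsto (fun ε : ℝ => Real.exp (-(ε⁻¹ * t₁))) (𝓝[>] 0) (𝓝 0) :=
    Real.tendsto_exp_neg_atTop_nhds_zero.comp
      (tendsto_inv_nhdsGT_zero.atTop_mul_const ht₁)
  have hlim : Tendsto (fun ε : ℝ => ((ψ (x t₁)).1, Real.exp (-(ε⁻¹ * t₁)) • (ψ x₀).2)) (𝓝[>] 0)
      (𝓝 (ψ (x t₁))) := by
    rw [hψx]
    refine tendsto_const_nhds.prodMk_nhds ?_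
    simpa using hexp.smul_const (ψ x₀).2
  have hmem : x t₁ ∈ ψ.source := h.source_eq.symm ▸ hxt
  -- The limit in coordinates is `ψ (x t₁)`, an interior point of the chart, so continuity of `ψ⁻¹`
  -- there carries it back.
  have hsymm := (ψ.continuousAt_symm (ψ.map_source hmem)).tendsto.comp hlim
  rw [ψ.left_inv hmem] at hsymm
  refine hsymm.congr' ?_
  filter_upwards [hbar, self_mem_nhdsWithin] with ε hε hpos
  have hpos' : ε ≠ 0 := ne_of_gt hpos
  rw [Function.comp_apply, ← h.perturbed_eq h0 hpos' ht₁ hx₀ hε.1 hε.2 hx hxV hxlim]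
  exact ψ.left_inv (h.source_eq.symm ▸ (hε.1 t₁ ht).1)

end IsWeierstrassChart

end DAE

theorem mainTheorem2 {n : ℕ} (Ξ : DAE (Vec n)) (xp : Vec n) (U : Set (Vec n))
    (hCR : Ξ.ConstantRankOn xp U) (hindex : Ξ.HasGeometricIndex xp 1)
    (hinv : Ξ.KerInvolutiveOn U) :
    (∃ (V : Set (Vec n)) (r s : ℕ) (Q : Vec n → Vec n →L[ℝ] Vec r × Vec s)
        (ψ : OpenPartialHomeomorph (Vec n) (Vec r × Vec s)),
      IsOpen V ∧ xp ∈ V ∧ V ⊆ U ∧ ContDiffOn ℝ ∞ Q V ∧ Ξ.IsEquivINWFOn V Q ψ) ∧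
    ∀ (V : Set (Vec n)) (r s : ℕ) (Q : Vec n → Vec n →L[ℝ] Vec r × Vec s)
        (ψ : OpenPartialHomeomorph (Vec n) (Vec r × Vec s)),
      IsOpen V → xp ∈ V → V ⊆ U → Ξ.IsEquivINWFOn V Q ψ →
      (∀ ε : ℝ, 0 < ε → ∀ x ∈ V, (Ξ.perturbedE Q ψ ε x).IsInvertible) ∧
      ∀ x₀m ∈ V, ¬ Ξ.IsConsistent x₀m →
        DAE.consistencyProjector ψ x₀m ∈ V ∧
        Ξ.IsConsistent (DAE.consistencyProjector ψ x₀m) ∧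
        ∀ (T : EReal) (I : Set ℝ), 0 < T → I = {t : ℝ | 0 < t ∧ (t : EReal) < T} →
        ∀ (xbar : ℝ → ℝ → Vec n) (x : ℝ → Vec n),
          (∀ᶠ ε in 𝓝[>] (0 : ℝ), Ξ.IsPerturbedSolutionOn Q ψ ε V I (xbar ε) ∧
            Tendsto (xbar ε) (𝓝[>] 0) (𝓝 x₀m)) →
          Ξ.IsSolutionOn I x → (∀ t ∈ I, x t ∈ V) →
          Tendsto x (𝓝[>] 0) (𝓝 (DAE.consistencyProjector ψ x₀m)) →
          ∀ t ∈ I, Tendsto (fun ε => ‖xbar ε t - x t‖) (𝓝[>] 0) (𝓝 0) := by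
  refine ⟨Ξ.exists_isEquivINWFOn xp U hCR hindex.1 hinv, ?_⟩
  intro V r s Q ψ _ hxpV _ hequiv
  obtain ⟨X₁, X₂, Fstar, h⟩ := hequiv.exists_isWeierstrassChart
  -- Since `xp ∈ M₁`, the algebraic equation holds there, so the second coordinate of `ψ xp` is
  -- zero.
  have h0 : (0 : Vec s) ∈ X₂ := by
    obtain ⟨-, v, hv⟩ := Ξ.mem_reduction_one.1 hindex.1.1
    rw [← (h.snd_eq_zero hxpV hv).2]
    exact (h.map_mem hxpV).2
  refine ⟨fun ε hε x hx => h.isInvertible_perturbedE hε.ne' hx, fun x₀ hx₀ _ =>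
    ⟨(h.consistencyProjector_mem h0 hx₀).1, h.isConsistent_consistencyProjector h0 hx₀, ?_⟩⟩
  rintro T I - rfl xbar x hbar hx hxV hxlim t ⟨ht, htT⟩
  -- Convergence at time `t` involves only the interval `(0, t]`, so finite and infinite `T` are
  -- treated alike.
  have hsub : ∀ τ ∈ Ioc 0 t, τ ∈ {t : ℝ | 0 < t ∧ (t : EReal) < T} := fun τ hτ =>
    ⟨hτ.1, (EReal.coe_le_coe_iff.2 hτ.2).trans_lt htT⟩
  have hlim := h.tendsto_perturbed h0 ht hx₀
    (hbar.mono fun ε hε => ⟨fun τ hτ => hε.1 τ (hsub τ hτ), hε.2⟩)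
    (fun τ hτ => hx τ (hsub τ hτ)) (fun τ hτ => hxV τ (hsub τ hτ)) hxlim
  exact tendsto_iff_norm_sub_tendsto_zero.1 hlim
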